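/- Let $p$ be a prime, $K$ a finite unramified extension of $\mathbb{Q}_p$ of degree $f$, and $E$ a finite extension of $\mathbb{Q}_p$ together with an embedding $\sigma_0:K\hookrightarrow E$. Let $\mathcal{O}_E$ be the ring of integers of $E$, $\pi$ a uniformizer, and $|\cdot|$ the absolute value of $E$ normalized by $|\pi|=p^{-1}$. Let $Y_{\sigma_0},\dots,Y_{\sigma_{f-1}}$ be variables, and for $\underline n\in\mathbb{Z}^{f-1}$ write $U^{\underline n}:=\prod_{i=1}^{f-1}(Y_{\sigma_i}/Y_{\sigma_0})^{n_i}$. Let $R$ be the $p$-adic completion of $\mathcal{O}_E[[Y_{\sigma_0}]][1/Y_{\sigma_0}]$, i.e. the ring of series $\sum_{m\in\mathbb{Z}}a_mY_{\sigma_0}^m$ with $a_m\in\mathcal{O}_E$ and $a_m\to0$ as $m\to-\infty$, with the topology in which the subgroups $\pi^kR+Y_{\sigma_0}^N\mathcal{O}_E[[Y_{\sigma_0}]]$ ($k,N\ge0$) form a basis of neighbourhoods of $0$. Put $$A_{\mathrm{mv},E}:=\Big\{\sum_{\underline n\in\mathbb{Z}^{f-1}}F_{\underline n}(Y_{\sigma_0})\,U^{\underline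 n}\;:\;F_{\underline n}\in R,\ \lim_{|\underline n|\to\infty}F_{\underline n}=0\Big\}.$$ For an integer $s\ge1$ let $A_E^{(p^{-1/s},1)}\subset R$ be the subring of series $\sum_{m\in\mathbb{Z}} a_mY_{\sigma_0}^m$ with $a_m\in\mathcal{O}_E$ and $|a_m|\,p^{-m/s}\le1$ for all $m$, endowed with the $(Y_{\sigma_0},\pi/Y_{\sigma_0}^s)$-adic topology, and let $$A_{\mathrm{mv},E}^{\dagger,s}:=\Big\{\sum_{\underline n\in\mathbb{Z}^{f-1}}F_{\underline n}(Y_{\sigma_0})\,U^{\underline n}\;:\;F_{\underline n}\in A_E^{(p^{-1/s},1)},\ \lim_{|\underline n|\to\infty}F_{\underline n}=0\Big\}\subset A_{\mathrm{mv},E},$$ $$A_{\mathrm{mv},E}^{\dagger,\infty}:=\bigcup_{s\ge1}A_{\mathrm{mv},E}^{\dagger,s},\qquad A_{\mathrm{mv},E}^{\dagger}:=A_{\mathrm{mv},E}^{\dagger,\infty}\Big[\frac1{Y_{\sigma_0}}\Big]\subset A_{\mathrm{mv},E}.$$ Then the inclusion $A_{\mathrm{mv},E}^{\dagger,\infty}\hookrightarrow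 A_{\mathrm{mv},E}$ is flat, and the inclusion $A_{\mathrm{mv},E}^{\dagger}\hookrightarrow A_{\mathrm{mv},E}$ is faithfully flat. -/

import Mathlib

namespace MvPhiGamma

open Filter Topology

section Convolution

variable {E : Type*} [NormedField E] {G : Type*} [AddCommGroup G]

/-- The Cauchy product of two families of coefficients indexed by `G`. -/
noncomputable def conv (a b : G → E) (g : G) : E := ∑' h, a h * b (g - h)

/-- Integral coefficients such that, for all `ε > 0` and `N`, only finitely many coefficients in
degrees `< N` have norm at least `ε`. -/
structure Good (deg : G →+ ℤ) (a : G → E) : Prop where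
  le_one : ∀ g, ‖a g‖ ≤ 1
  finite : ∀ ε > 0, ∀ N : ℤ, {g | deg g < N ∧ ε ≤ ‖a g‖}.Finite

variable {deg : G →+ ℤ} {a b c : G → E}

theorem Good.bddBelow (ha : Good deg a) {ε : ℝ} (hε : 0 < ε) :
    ∃ B : ℤ, ∀ g, ε ≤ ‖a g‖ → B ≤ deg g := by
  obtain ⟨B, hB⟩ := ((ha.finite ε hε 0).image deg).bddBelow
  refine ⟨min B 0, fun g hg => ?_⟩
  by_cases h : deg g < 0
  · exact (min_le_left _ _).trans (hB ⟨g, ⟨h, hg⟩, rfl⟩)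
  · exact (min_le_right _ _).trans (not_lt.1 h)

theorem norm_mul_ge {x y : E} {ε : ℝ} (hx : ‖x‖ ≤ 1) (hy : ‖y‖ ≤ 1) (h : ε ≤ ‖x * y‖) :
    ε ≤ ‖x‖ ∧ ε ≤ ‖y‖ := by
  rw [norm_mul] at h
  have := norm_nonneg x
  have := norm_nonneg y
  constructor <;> nlinarith

theorem Good.pairs (ha : Good deg a) (hb : Good deg b) {ε : ℝ} (hε : 0 < ε) (N : ℤ) :
    {u : G × G | deg u.1 + deg u.2 < N ∧ ε ≤ ‖a u.1‖ ∧ ε ≤ ‖b u.2‖}.Finite := by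
  obtain ⟨A, hA⟩ := ha.bddBelow hε
  obtain ⟨B, hB⟩ := hb.bddBelow hε
  refine ((ha.finite ε hε (N - B)).prod (hb.finite ε hε (N - A))).subset ?_
  rintro ⟨g, h⟩ ⟨h1, h2, h3⟩
  have := hA _ h2
  have := hB _ h3
  refine ⟨⟨?_, h2⟩, ⟨?_, h3⟩⟩ <;> simp only at * <;> omega

section Ultra

variable [IsUltrametricDist E]

theorem summable_of_finite [CompleteSpace E] {ι : Type*} {x : ι → E}
    (h : ∀ ε > 0, {i | ε ≤ ‖x i‖}.Finite) : Summable x := by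
  apply NonarchimedeanAddGroup.summable_of_tendsto_cofinite_zero
  rw [tendsto_zero_iff_norm_tendsto_zero, Metric.tendsto_nhds]
  intro ε hε
  refine (h ε hε).subset ?_
  intro i hi
  simpa using hi

theorem Good.conv_summable [CompleteSpace E] (ha : Good deg a) (hb : Good deg b) (g : G) :
    Summable fun h => a h * b (g - h) := by
  apply summable_of_finite
  intro ε hε
  refine ((ha.pairs hb hε (deg g + 1)).image Prod.fst).subset ?_
  intro h hh
  refine ⟨(h, g - h), ⟨?_, norm_mul_ge (ha.le_one _) (hb.le_one _) hh⟩, rfl⟩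
  simp

theorem norm_tsum_le_of {ι : Type*} {x : ι → E} {C : ℝ} (hC : 0 ≤ C) (h : ∀ i, ‖x i‖ ≤ C) :
    ‖∑' i, x i‖ ≤ C :=
  IsUltrametricDist.norm_tsum_le_of_forall_le_of_nonneg hC h

theorem Good.conv (ha : Good deg a) (hb : Good deg b) : Good deg (conv a b) where
  le_one g := norm_tsum_le_of zero_le_one fun h => by
    rw [norm_mul]; exact mul_le_one₀ (ha.le_one _) (norm_nonneg _) (hb.le_one _)
  finite ε hε N := by
    refine ((ha.pairs hb (half_pos hε) N).image fun u => u.1 + u.2).subset ?_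
    rintro g ⟨hg, hn⟩
    obtain ⟨h, hh⟩ : ∃ h, ε / 2 ≤ ‖a h * b (g - h)‖ := by
      by_contra! H
      have := norm_tsum_le_of (half_pos hε).le fun h => (H h).le
      unfold MvPhiGamma.conv at hn
      linarith
    refine ⟨(h, g - h), ⟨?_, norm_mul_ge (ha.le_one _) (hb.le_one _) hh⟩, by simp⟩
    simpa using hg

theorem Good.add (ha : Good deg a) (hb : Good deg b) : Good deg (a + b) where
  le_one g := (IsUltrametricDist.norm_add_le_max _ _).trans (max_le (ha.le_one g) (hb.le_one g))
  finite ε hε N := by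
    refine ((ha.finite ε hε N).union (hb.finite ε hε N)).subset ?_
    rintro g ⟨hg, hn⟩
    rcases le_max_iff.1 (hn.trans (IsUltrametricDist.norm_add_le_max _ _)) with h | h
    · exact Or.inl ⟨hg, h⟩
    · exact Or.inr ⟨hg, h⟩

theorem conv_add [CompleteSpace E] (ha : Good deg a) (hb : Good deg b) (hc : Good deg c) :
    conv a (b + c) = conv a b + conv a c := by
  ext g
  simp only [conv, Pi.add_apply, mul_add]
  exact (ha.conv_summable hb g).tsum_add (ha.conv_summable hc g)

theorem conv_assoc [CompleteSpace E] (ha : Good deg a) (hb : Good deg b) (hc : Good deg c) :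
    conv (conv a b) c = conv a (conv b c) := by
  ext g
  have key : Summable (Function.uncurry fun h k : G => a k * b (h - k) * c (g - h)) := by
    apply summable_of_finite
    intro ε hε
    obtain ⟨C, hC⟩ := hc.bddBelow hε
    refine ((ha.pairs hb hε (deg g - C + 1)).image fun u => (u.1 + u.2, u.1)).subset ?_
    rintro ⟨h, k⟩ hh
    have hab : ‖a k * b (h - k)‖ ≤ 1 := by
      rw [norm_mul]; exact mul_le_one₀ (ha.le_one _) (norm_nonneg _) (hb.le_one _)
    obtain ⟨h1, h2⟩ := norm_mul_ge hab (hc.le_one (g - h)) hh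
    refine ⟨(k, h - k), ⟨?_, norm_mul_ge (ha.le_one _) (hb.le_one _) h1⟩, by simp⟩
    have := hC _ h2
    simp only [map_sub] at *
    omega
  have e1 : conv (conv a b) c g = ∑' h, ∑' k, a k * b (h - k) * c (g - h) := by
    simp only [conv, tsum_mul_right]
  have e2 : conv a (conv b c) g = ∑' k, ∑' h, a k * b (h - k) * c (g - h) := by
    simp only [conv, ← tsum_mul_left]
    refine tsum_congr fun k => ?_
    rw [← (Equiv.subRight k).tsum_eq]
    refine tsum_congr fun h => ?_
    simp [mul_assoc]
  rw [e1, e2]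
  exact key.tsum_comm.symm

end Ultra

theorem Good.neg (ha : Good deg a) : Good deg (-a) where
  le_one g := by simpa using ha.le_one g
  finite ε hε N := by simpa using ha.finite ε hε N

theorem Good.single [DecidableEq G] (u : G) {x : E} (hx : ‖x‖ ≤ 1) :
    Good deg (Pi.single u x) where
  le_one g := by
    by_cases h : g = u
    · subst h; simpa using hx
    · simp [h]
  finite ε hε N := by
    refine (Set.finite_singleton u).subset ?_
    rintro g ⟨-, hg⟩
    by_contra h
    rw [Pi.single_eq_of_ne h, norm_zero] at hg
    linarith

theorem Good.zero : Good deg (0 : G → E) where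
  le_one g := by simp
  finite ε hε N := by
    convert Set.finite_empty
    ext g
    simp [hε]

theorem conv_comm (a b : G → E) : conv a b = conv b a := by
  ext g
  rw [conv, ← (Equiv.subLeft g).tsum_eq]
  simp [conv, mul_comm]

theorem single_conv [DecidableEq G] (u : G) (x : E) (b : G → E) (g : G) :
    conv (Pi.single u x) b g = x * b (g - u) := by
  rw [conv, tsum_eq_single u]
  · simp
  · intro h hh
    simp [hh]

theorem one_conv [DecidableEq G] (b : G → E) : conv (Pi.single 0 1) b = b := by
  ext g
  simp [single_conv]

theorem zero_conv (b : G → E) : conv 0 b = 0 := by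
  ext g
  simp [conv]

end Convolution

section LocalField

theorem isUltrametricDist (p : ℕ) [Fact p.Prime] (E : Type*) [NormedField E]
    [NormedAlgebra ℚ_[p] E] : IsUltrametricDist E :=
  IsUltrametricDist.of_normedAlgebra ℚ_[p]

theorem completeSpace (p : ℕ) [Fact p.Prime] (E : Type*) [NormedField E]
    [NormedAlgebra ℚ_[p] E] [FiniteDimensional ℚ_[p] E] : CompleteSpace E :=
  FiniteDimensional.complete ℚ_[p] E

end LocalField

/-- The `p`-adic completion of `O_E[[Y]][1/Y]`, where `O_E = {x ∈ E | ‖x‖ ≤ 1}`: the ring of series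
`∑_{m ∈ ℤ} a_m Y^m` with `a_m ∈ O_E` and `a_m → 0` as `m → -∞`. -/
@[ext]
structure LaurentHat (p : ℕ) (E : Type*) [NormedField E] where
  coeff : ℤ → E
  norm_coeff_le : ∀ m, ‖coeff m‖ ≤ 1
  tendsto_coeff : Tendsto coeff atBot (𝓝 0)

/-- A family of series in `LaurentHat p E` tends to zero (along the cofinite filter) for the
`(π, Y)`-adic topology, that is the topology in which the subgroups
`π ^ k • LaurentHat p E + Y ^ N • O_E[[Y]]` form a basis of neighbourhoods of zero. -/
def TendstoZero {p : ℕ} {E : Type*} [NormedField E] {L : Type*} (F : L → LaurentHat p E) : Prop :=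
  ∀ ε > 0, ∀ N : ℤ, ∀ᶠ n in cofinite, ∀ m < N, ‖(F n).coeff m‖ < ε

/-- The ring `A_{mv,E}` in `f` variables: series `∑_{n ∈ ℤ^{f-1}} F_n(Y_0) ∏_i (Y_i/Y_0)^{n_i}` with
coefficients `F_n` in `LaurentHat p E` tending to zero. -/
@[ext]
structure Amv (p : ℕ) (E : Type*) [NormedField E] (f : ℕ) where
  coeff : (Fin (f - 1) → ℤ) → LaurentHat p E
  tendsto_coeff : TendstoZero coeff

section Rings

variable {p : ℕ} {E : Type*} [NormedField E]

theorem LaurentHat.good (a : LaurentHat p E) : Good (AddMonoidHom.id ℤ) a.coeff where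
  le_one := a.norm_coeff_le
  finite ε hε N := by
    have h := Metric.tendsto_nhds.1 a.tendsto_coeff ε hε
    obtain ⟨B, hB⟩ := eventually_atBot.1 h
    refine (Set.finite_Ico B N).subset ?_
    rintro m ⟨hm, hn⟩
    refine ⟨?_, hm⟩
    by_contra H
    have := hB m (not_le.1 H).le
    rw [dist_zero_right] at this
    linarith

/-- The series with given good coefficients. -/
def LaurentHat.mk' (a : ℤ → E) (ha : Good (AddMonoidHom.id ℤ) a) : LaurentHat p E where
  coeff := a
  norm_coeff_le := ha.le_one
  tendsto_coeff := by
    rw [Metric.tendsto_nhds]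
    intro ε hε
    obtain ⟨B, hB⟩ := ha.bddBelow hε
    refine eventually_atBot.2 ⟨B - 1, fun m hm => ?_⟩
    rw [dist_zero_right]
    by_contra! H
    have := hB m H
    simp at this
    omega

/-- The degree in `Y_0`. -/
def degY (L : Type*) [AddCommGroup L] : L × ℤ →+ ℤ := AddMonoidHom.snd L ℤ

/-- All coefficients of an element of `A_{mv,E}`. -/
def Amv.fn {f : ℕ} (a : Amv p E f) (u : (Fin (f - 1) → ℤ) × ℤ) : E := (a.coeff u.1).coeff u.2

theorem Amv.fn_injective {f : ℕ} : Function.Injective (Amv.fn : Amv p E f → _) := by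
  intro a b h
  ext n m
  exact congrFun h (n, m)

theorem Amv.good {f : ℕ} (a : Amv p E f) : Good (degY _) a.fn where
  le_one g := (a.coeff g.1).norm_coeff_le _
  finite ε hε N := by
    have h1 : {n | ¬ ∀ m < N, ‖(a.coeff n).coeff m‖ < ε}.Finite := a.tendsto_coeff ε hε N
    refine (h1.biUnion fun n _ =>
      ((a.coeff n).good.finite ε hε N).image fun m => (n, m)).subset ?_
    rintro ⟨n, m⟩ ⟨hm, hn⟩
    simp only [Set.mem_iUnion]
    refine ⟨n, fun H => ?_, m, ⟨hm, hn⟩, rfl⟩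
    exact absurd (H m hm) (not_lt.2 hn)

/-- The element of `A_{mv,E}` with given good coefficients. -/
def Amv.mk' {f : ℕ} (a : (Fin (f - 1) → ℤ) × ℤ → E) (ha : Good (degY _) a) : Amv p E f where
  coeff n := LaurentHat.mk' (fun m => a (n, m))
    { le_one := fun m => ha.le_one (n, m)
      finite := fun ε hε N =>
        (ha.finite ε hε N).preimage ((Prod.mk_right_injective n).injOn) }
  tendsto_coeff ε hε N := by
    refine ((ha.finite ε hε N).image Prod.fst).subset ?_
    intro n hn
    simp only [Set.mem_compl_iff, Set.mem_ofPred_eq, not_forall, not_lt] at hn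
    obtain ⟨m, hm, h⟩ := hn
    exact ⟨(n, m), ⟨hm, h⟩, rfl⟩

@[simp]
theorem LaurentHat.coeff_mk' (a : ℤ → E) (ha : Good (AddMonoidHom.id ℤ) a) :
    (LaurentHat.mk' a ha : LaurentHat p E).coeff = a := rfl

@[simp]
theorem Amv.fn_mk' {f : ℕ} (a : (Fin (f - 1) → ℤ) × ℤ → E) (ha : Good (degY _) a) :
    (Amv.mk' a ha : Amv p E f).fn = a := rfl

variable [Fact p.Prime] [NormedAlgebra ℚ_[p] E] [FiniteDimensional ℚ_[p] E]

noncomputable instance : Zero (LaurentHat p E) := ⟨.mk' 0 Good.zero⟩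

noncomputable instance : One (LaurentHat p E) :=
  ⟨.mk' (Pi.single 0 1) (Good.single 0 (by simp))⟩

noncomputable instance : Neg (LaurentHat p E) := ⟨fun a => .mk' (-a.coeff) a.good.neg⟩

/-- Coefficientwise addition. -/
noncomputable instance : Add (LaurentHat p E) :=
  haveI := isUltrametricDist p E
  ⟨fun a b => .mk' (a.coeff + b.coeff) (a.good.add b.good)⟩

/-- The Cauchy product. -/
noncomputable instance : Mul (LaurentHat p E) :=
  haveI := isUltrametricDist p E
  ⟨fun a b => .mk' (conv a.coeff b.coeff) (a.good.conv b.good)⟩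

noncomputable instance : CommRing (LaurentHat p E) :=
  haveI := isUltrametricDist p E
  haveI := completeSpace p E
  { nsmul := nsmulRec
    zsmul := zsmulRec
    add_assoc := fun a b c => LaurentHat.ext (add_assoc a.coeff b.coeff c.coeff)
    zero_add := fun a => LaurentHat.ext (zero_add a.coeff)
    add_zero := fun a => LaurentHat.ext (add_zero a.coeff)
    add_comm := fun a b => LaurentHat.ext (add_comm a.coeff b.coeff)
    neg_add_cancel := fun a => LaurentHat.ext (neg_add_cancel a.coeff)
    mul_assoc := fun a b c => LaurentHat.ext (conv_assoc a.good b.good c.good)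
    mul_comm := fun a b => LaurentHat.ext (conv_comm _ _)
    one_mul := fun a => LaurentHat.ext (one_conv _)
    mul_one := fun a => LaurentHat.ext ((conv_comm _ _).trans (one_conv _))
    zero_mul := fun a => LaurentHat.ext (zero_conv _)
    mul_zero := fun a => LaurentHat.ext ((conv_comm _ _).trans (zero_conv _))
    left_distrib := fun a b c => LaurentHat.ext (conv_add a.good b.good c.good)
    right_distrib := fun a b c => LaurentHat.ext <|
      (conv_comm _ _).trans <| (conv_add c.good a.good b.good).trans <|
        congrArg₂ (· + ·) (conv_comm _ _) (conv_comm _ _) }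

@[simp] theorem LaurentHat.coeff_zero : (0 : LaurentHat p E).coeff = 0 := rfl
@[simp] theorem LaurentHat.coeff_one : (1 : LaurentHat p E).coeff = Pi.single 0 1 := rfl
@[simp] theorem LaurentHat.coeff_add (a b : LaurentHat p E) :
    (a + b).coeff = a.coeff + b.coeff := rfl
@[simp] theorem LaurentHat.coeff_neg (a : LaurentHat p E) : (-a).coeff = -a.coeff := rfl
@[simp] theorem LaurentHat.coeff_mul (a b : LaurentHat p E) :
    (a * b).coeff = conv a.coeff b.coeff := rfl

noncomputable instance {f : ℕ} : Zero (Amv p E f) := ⟨.mk' 0 Good.zero⟩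

noncomputable instance {f : ℕ} : One (Amv p E f) :=
  ⟨.mk' (Pi.single 0 1) (Good.single 0 (by simp))⟩

noncomputable instance {f : ℕ} : Neg (Amv p E f) := ⟨fun a => .mk' (-a.fn) a.good.neg⟩

/-- Coefficientwise addition. -/
noncomputable instance {f : ℕ} : Add (Amv p E f) :=
  haveI := isUltrametricDist p E
  ⟨fun a b => .mk' (a.fn + b.fn) (a.good.add b.good)⟩

/-- The Cauchy product. -/
noncomputable instance {f : ℕ} : Mul (Amv p E f) :=
  haveI := isUltrametricDist p E
  ⟨fun a b => .mk' (conv a.fn b.fn) (a.good.conv b.good)⟩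

noncomputable instance {f : ℕ} : CommRing (Amv p E f) :=
  haveI := isUltrametricDist p E
  haveI := completeSpace p E
  { nsmul := nsmulRec
    zsmul := zsmulRec
    add_assoc := fun a b c => Amv.fn_injective (add_assoc a.fn b.fn c.fn)
    zero_add := fun a => Amv.fn_injective (zero_add a.fn)
    add_zero := fun a => Amv.fn_injective (add_zero a.fn)
    add_comm := fun a b => Amv.fn_injective (add_comm a.fn b.fn)
    neg_add_cancel := fun a => Amv.fn_injective (neg_add_cancel a.fn)
    mul_assoc := fun a b c => Amv.fn_injective (conv_assoc a.good b.good c.good)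
    mul_comm := fun a b => Amv.fn_injective (conv_comm _ _)
    one_mul := fun a => Amv.fn_injective (one_conv _)
    mul_one := fun a => Amv.fn_injective ((conv_comm _ _).trans (one_conv _))
    zero_mul := fun a => Amv.fn_injective (zero_conv _)
    mul_zero := fun a => Amv.fn_injective ((conv_comm _ _).trans (zero_conv _))
    left_distrib := fun a b c => Amv.fn_injective (conv_add a.good b.good c.good)
    right_distrib := fun a b c => Amv.fn_injective <|
      (conv_comm _ _).trans <| (conv_add c.good a.good b.good).trans <|
        congrArg₂ (· + ·) (conv_comm _ _) (conv_comm _ _) }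

variable {f : ℕ}

@[simp] theorem Amv.fn_zero : (0 : Amv p E f).fn = 0 := rfl
@[simp] theorem Amv.fn_one : (1 : Amv p E f).fn = Pi.single 0 1 := rfl
@[simp] theorem Amv.fn_add (a b : Amv p E f) : (a + b).fn = a.fn + b.fn := rfl
@[simp] theorem Amv.fn_neg (a : Amv p E f) : (-a).fn = -a.fn := rfl
@[simp] theorem Amv.fn_mul (a b : Amv p E f) : (a * b).fn = conv a.fn b.fn := rfl

end Rings

section Uniformizer

variable {E : Type*} [NormedField E]

/-- `ϖ` generates the maximal ideal `{‖x‖ < 1}` of the ring of integers `{‖x‖ ≤ 1}` of `E`. -/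
def IsUniformizer (ϖ : E) : Prop :=
  ϖ ≠ 0 ∧ ∀ x : E, ‖x‖ < 1 ↔ ∃ y : E, ‖y‖ ≤ 1 ∧ x = ϖ * y

/-- The power of the absolute value of `E` which is normalized by `|ϖ| = p⁻¹`. -/
noncomputable def normalizedNorm (p : ℕ) (ϖ x : E) : ℝ :=
  ‖x‖ ^ (-Real.log p / Real.log ‖ϖ‖)

variable {ϖ : E}

theorem IsUniformizer.norm_pos (hϖ : IsUniformizer ϖ) : 0 < ‖ϖ‖ := norm_pos_iff.2 hϖ.1

theorem IsUniformizer.norm_lt_one (hϖ : IsUniformizer ϖ) : ‖ϖ‖ < 1 :=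
  (hϖ.2 ϖ).2 ⟨1, by simp, by simp⟩

theorem IsUniformizer.exists_norm_eq (hϖ : IsUniformizer ϖ) {x : E} (hx : x ≠ 0) (h1 : ‖x‖ ≤ 1) :
    ∃ v : ℕ, ‖x‖ = ‖ϖ‖ ^ v := by
  obtain ⟨v, hv, hv'⟩ := exists_nat_pow_near_of_lt_one (norm_pos_iff.2 hx) h1 hϖ.norm_pos
    hϖ.norm_lt_one
  refine ⟨v, le_antisymm hv' (not_lt.1 fun hlt => ?_)⟩
  have hp : 0 < ‖ϖ‖ ^ v := pow_pos hϖ.norm_pos v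
  obtain ⟨y, hy, hxy⟩ := (hϖ.2 (x / ϖ ^ v)).1 (by rw [norm_div, norm_pow, div_lt_one hp]; exact hlt)
  have : x = ϖ ^ (v + 1) * y := by
    rw [div_eq_iff (pow_ne_zero _ hϖ.1)] at hxy
    rw [hxy]; ring
  rw [this, norm_mul, norm_pow] at hv
  have := pow_pos hϖ.norm_pos (v + 1)
  nlinarith

section

variable {p : ℕ} [hp : Fact p.Prime]

theorem IsUniformizer.exponent_pos (hϖ : IsUniformizer ϖ) :
    0 < -Real.log p / Real.log ‖ϖ‖ := by
  have h1 : Real.log ‖ϖ‖ < 0 := Real.log_neg hϖ.norm_pos hϖ.norm_lt_one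
  have h2 : 0 < Real.log p := Real.log_pos (by exact_mod_cast hp.out.one_lt)
  exact div_pos_of_neg_of_neg (by linarith) h1

theorem IsUniformizer.rpow_eq (hϖ : IsUniformizer ϖ) (v : ℕ) :
    (‖ϖ‖ ^ v) ^ (-Real.log p / Real.log ‖ϖ‖) = (p : ℝ) ^ (-(v : ℝ)) := by
  have h1 : Real.log ‖ϖ‖ < 0 := Real.log_neg hϖ.norm_pos hϖ.norm_lt_one
  have h0 : (0 : ℝ) < p := by exact_mod_cast hp.out.pos
  rw [Real.rpow_def_of_pos (pow_pos hϖ.norm_pos v), Real.rpow_def_of_pos h0, Real.log_pow]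
  have h2 := h1.ne
  congr 1
  field_simp

theorem normalizedNorm_nonneg (x : E) : 0 ≤ normalizedNorm p ϖ x :=
  Real.rpow_nonneg (norm_nonneg x) _

theorem normalizedNorm_mul (x y : E) :
    normalizedNorm p ϖ (x * y) = normalizedNorm p ϖ x * normalizedNorm p ϖ y := by
  simp only [normalizedNorm, norm_mul]
  exact Real.mul_rpow (norm_nonneg x) (norm_nonneg y)

theorem normalizedNorm_one : normalizedNorm p ϖ (1 : E) = 1 := by
  simp [normalizedNorm]

theorem IsUniformizer.normalizedNorm_zero (hϖ : IsUniformizer ϖ) :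
    normalizedNorm p ϖ (0 : E) = 0 := by
  rw [normalizedNorm, norm_zero, Real.zero_rpow (hϖ.exponent_pos (p := p)).ne']

theorem IsUniformizer.normalizedNorm_le_iff (hϖ : IsUniformizer ϖ) (x : E) {C : ℝ} (hC : 0 ≤ C) :
    normalizedNorm p ϖ x ≤ C ↔ ‖x‖ ≤ C ^ (-Real.log p / Real.log ‖ϖ‖)⁻¹ :=
  (Real.le_rpow_inv_iff_of_pos (norm_nonneg x) hC hϖ.exponent_pos).symm

theorem IsUniformizer.normalizedNorm_self (hϖ : IsUniformizer ϖ) :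
    normalizedNorm p ϖ ϖ = (p : ℝ)⁻¹ := by
  have := hϖ.rpow_eq (p := p) 1
  rw [pow_one] at this
  rw [normalizedNorm, this, Nat.cast_one, Real.rpow_neg_one]

/-- The radius `p ^ (-1 / s)`. -/
noncomputable def radius (p : ℕ) (s : ℕ+) : ℝ := (p : ℝ) ^ (-(1 / (s : ℝ)))

theorem radius_pos (s : ℕ+) : 0 < radius p s :=
  Real.rpow_pos_of_pos (by exact_mod_cast hp.out.pos) _

/-- The monomial `x Y ^ m` has order at least `k` for the ideal `(Y, ϖ / Y ^ s)`. -/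
def Ord (ϖ : E) (s : ℕ+) (k : ℕ) (m : ℤ) (x : E) : Prop :=
  ∃ v : ℕ, ‖x‖ ≤ ‖ϖ‖ ^ v ∧ 0 ≤ m + s * v ∧ (k : ℤ) ≤ v + (m + s * v)

theorem Ord.zero (s : ℕ+) (k : ℕ) (m : ℤ) : Ord ϖ s k m (0 : E) := by
  have hs : (1 : ℤ) ≤ (s : ℕ) := by exact_mod_cast s.pos
  have := abs_nonneg m
  have := neg_abs_le m
  refine ⟨m.natAbs + k, ?_, ?_, ?_⟩
  · rw [norm_zero]; positivity
  · push_cast; nlinarith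
  · push_cast; nlinarith

theorem Ord.mono {s : ℕ+} {k k' : ℕ} (h : k' ≤ k) {m : ℤ} {x : E} (hx : Ord ϖ s k m x) :
    Ord ϖ s k' m x := by
  obtain ⟨v, h1, h2, h3⟩ := hx
  exact ⟨v, h1, h2, by omega⟩

theorem Ord.mul {s : ℕ+} {k k' : ℕ} {m m' : ℤ} {x x' : E} (hx : Ord ϖ s k m x)
    (hx' : Ord ϖ s k' m' x') : Ord ϖ s (k + k') (m + m') (x * x') := by
  obtain ⟨v, h1, h2, h3⟩ := hx
  obtain ⟨v', h1', h2', h3'⟩ := hx'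
  refine ⟨v + v', ?_, ?_, ?_⟩
  · rw [norm_mul, pow_add]
    exact mul_le_mul h1 h1' (norm_nonneg _) (by positivity)
  · push_cast; linarith
  · push_cast; linarith

theorem Ord.exists_bound (hϖ : IsUniformizer ϖ) (s : ℕ+) (k : ℕ) (m : ℤ) :
    ∃ w : ℕ, ∀ x : E, Ord ϖ s k m x ↔ ‖x‖ ≤ ‖ϖ‖ ^ w := by
  classical
  have hex : ∃ v : ℕ, 0 ≤ m + s * v ∧ (k : ℤ) ≤ v + (m + s * v) := by
    obtain ⟨v, -, h⟩ := Ord.zero (ϖ := ϖ) s k m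
    exact ⟨v, h⟩
  refine ⟨Nat.find hex, fun x => ⟨?_, fun h => ⟨_, h, Nat.find_spec hex⟩⟩⟩
  rintro ⟨v, h1, h2⟩
  exact h1.trans (pow_le_pow_of_le_one hϖ.norm_pos.le hϖ.norm_lt_one.le (Nat.find_min' hex h2))

theorem Ord.tsum [IsUltrametricDist E] (hϖ : IsUniformizer ϖ) {s : ℕ+} {k : ℕ} {m : ℤ}
    {ι : Type*} {x : ι → E} (hx : ∀ i, Ord ϖ s k m (x i)) : Ord ϖ s k m (∑' i, x i) := by
  obtain ⟨w, hw⟩ := Ord.exists_bound hϖ s k m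
  rw [hw]
  exact norm_tsum_le_of (by positivity) fun i => (hw _).1 (hx i)

theorem Ord.add [IsUltrametricDist E] (hϖ : IsUniformizer ϖ) {s : ℕ+} {k : ℕ} {m : ℤ}
    {x y : E} (hx : Ord ϖ s k m x) (hy : Ord ϖ s k m y) : Ord ϖ s k m (x + y) := by
  obtain ⟨w, hw⟩ := Ord.exists_bound hϖ s k m
  rw [hw] at *
  exact (IsUltrametricDist.norm_add_le_max _ _).trans (max_le hx hy)

theorem Ord.neg {s : ℕ+} {k : ℕ} {m : ℤ} {x : E} (hx : Ord ϖ s k m x) : Ord ϖ s k m (-x) := by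
  obtain ⟨v, h⟩ := hx
  exact ⟨v, by rwa [norm_neg]⟩

theorem IsUniformizer.ord_zero_iff (hϖ : IsUniformizer ϖ) (s : ℕ+) (m : ℤ) {x : E}
    (hx : ‖x‖ ≤ 1) : normalizedNorm p ϖ x * radius p s ^ m ≤ 1 ↔ Ord ϖ s 0 m x := by
  have hp1 : (1 : ℝ) < p := by exact_mod_cast hp.out.one_lt
  have hp0 : (0 : ℝ) < p := by linarith
  have hs : (0 : ℝ) < (s : ℕ) := by exact_mod_cast s.pos
  have key : ∀ v : ℕ, (p : ℝ) ^ (-(v : ℝ)) * radius p s ^ m ≤ 1 ↔ 0 ≤ m + (s : ℕ) * (v : ℤ) := by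
    intro v
    rw [radius, ← Real.rpow_intCast, ← Real.rpow_mul hp0.le, ← Real.rpow_add hp0]
    have h0 := Real.rpow_le_rpow_left_iff (y := -(v : ℝ) + -(1 / ((s : ℕ) : ℝ)) * m) (z := 0) hp1
    rw [Real.rpow_zero] at h0
    rw [h0]
    have e : -(v : ℝ) + -(1 / ((s : ℕ) : ℝ)) * m = -((m + (s : ℕ) * v) / (s : ℕ)) := by
      field_simp
      ring
    rw [e, neg_nonpos, le_div_iff₀ hs, zero_mul]
    exact_mod_cast Iff.rfl
  constructor
  · intro h
    by_cases hx0 : x = 0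
    · subst hx0; exact Ord.zero s 0 m
    obtain ⟨v, hv⟩ := hϖ.exists_norm_eq hx0 hx
    rw [normalizedNorm, hv, hϖ.rpow_eq, key] at h
    refine ⟨v, hv.le, h, ?_⟩
    push_cast
    omega
  · rintro ⟨v, h1, h2, -⟩
    refine le_trans (mul_le_mul_of_nonneg_right ?_ (zpow_nonneg (radius_pos s).le m)) ((key v).2 h2)
    rw [← hϖ.rpow_eq]
    exact Real.rpow_le_rpow (norm_nonneg x) h1 hϖ.exponent_pos.le

end

end Uniformizer

section Dagger

variable (p : ℕ) [Fact p.Prime] {E : Type*} [NormedField E] [NormedAlgebra ℚ_[p] E]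
  [FiniteDimensional ℚ_[p] E] {ϖ : E} (hϖ : IsUniformizer ϖ)

/-- The ring `A_E^{(ρ,1)}` of series `∑ a_m Y^m` with `a_m ∈ O_E` and `|a_m| ρ ^ m ≤ 1` for all
`m ∈ ℤ`, as a subring of `LaurentHat p E`. -/
def annulusRing (ρ : ℝ) (hρ : 0 < ρ) : Subring (LaurentHat p E) where
  carrier := {a | ∀ m : ℤ, normalizedNorm p ϖ (a.coeff m) * ρ ^ m ≤ 1}
  zero_mem' m := by simp [hϖ.normalizedNorm_zero]
  one_mem' m := by
    by_cases h : m = 0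
    · subst h; simp [normalizedNorm_one]
    · simp [h, hϖ.normalizedNorm_zero]
  neg_mem' {a} ha m := by simpa [normalizedNorm] using ha m
  add_mem' {a b} ha hb m := by
    have := isUltrametricDist p E
    have hm := zpow_pos hρ m
    have ha := ha m
    have hb := hb m
    rw [← le_div_iff₀ hm, hϖ.normalizedNorm_le_iff _ (by positivity)] at *
    exact (IsUltrametricDist.norm_add_le_max _ _).trans (max_le ha hb)
  mul_mem' {a b} ha hb m := by
    have := isUltrametricDist p E
    have hm := zpow_pos hρ m
    rw [← le_div_iff₀ hm, hϖ.normalizedNorm_le_iff _ (by positivity)]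
    refine norm_tsum_le_of (by positivity) fun h => ?_
    rw [← hϖ.normalizedNorm_le_iff (p := p) _ (by positivity), le_div_iff₀ hm, normalizedNorm_mul]
    have e : ρ ^ m = ρ ^ h * ρ ^ (m - h) := by rw [← zpow_add₀ hρ.ne']; congr 1; ring
    rw [e, mul_mul_mul_comm]
    exact mul_le_one₀ (ha h) (mul_nonneg (normalizedNorm_nonneg _) (zpow_nonneg hρ.le _))
      (hb (m - h))

/-- The ring `A_E^{(p^{-1/s},1)}`. -/
noncomputable abbrev annulus (s : ℕ+) : Subring (LaurentHat p E) :=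
  annulusRing p hϖ (radius p s) (radius_pos s)

/-- The monomial `c Y ^ m`. -/
noncomputable def monomial (m : ℤ) (c : E) (hc : ‖c‖ ≤ 1) : LaurentHat p E :=
  .mk' (Pi.single m c) (Good.single m hc)

theorem mem_annulus_iff {s : ℕ+} {a : LaurentHat p E} :
    a ∈ annulus p hϖ s ↔ ∀ m, Ord ϖ s 0 m (a.coeff m) :=
  forall_congr' fun m => hϖ.ord_zero_iff s m (a.norm_coeff_le m)

theorem monomial_mem {s : ℕ+} {m : ℤ} {c : E} (hc : ‖c‖ ≤ 1) {k : ℕ} (h : Ord ϖ s k m c) (i : ℤ) :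
    Ord ϖ s k i ((monomial p m c hc).coeff i) := by
  by_cases hi : i = m
  · subst hi; simpa [monomial] using h
  · simpa [monomial, hi] using Ord.zero s k i

theorem ord_Y (s : ℕ+) : Ord ϖ s 1 1 (1 : E) := ⟨0, by simp⟩

theorem ord_X (s : ℕ+) : Ord ϖ s 1 (-(s : ℤ)) ϖ := ⟨1, by simp⟩

/-- The element `Y` of `A_E^{(p^{-1/s},1)}`. -/
noncomputable def annulusY (s : ℕ+) : annulus p hϖ s :=
  ⟨monomial p 1 1 (by simp), (mem_annulus_iff p hϖ).2 fun i =>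
    monomial_mem p _ ((ord_Y s).mono zero_le_one) i⟩

/-- The element `ϖ / Y ^ s` of `A_E^{(p^{-1/s},1)}`. -/
noncomputable def annulusX (s : ℕ+) : annulus p hϖ s :=
  ⟨monomial p (-(s : ℤ)) ϖ hϖ.norm_lt_one.le, (mem_annulus_iff p hϖ).2 fun i =>
    monomial_mem p _ ((ord_X s).mono zero_le_one) i⟩

/-- The ideal `(Y, ϖ / Y ^ s)` of `A_E^{(p^{-1/s},1)}`. -/
noncomputable def annulusIdeal (s : ℕ+) : Ideal (annulus p hϖ s) :=
  Ideal.span {annulusY p hϖ s, annulusX p hϖ s}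

theorem conv_ord [IsUltrametricDist E] (hϖ : IsUniformizer ϖ) {s : ℕ+} {k k' : ℕ} {a b : ℤ → E} (ha : ∀ m, Ord ϖ s k m (a m))
    (hb : ∀ m, Ord ϖ s k' m (b m)) (m : ℤ) : Ord ϖ s (k + k') m (conv a b m) := by
  refine Ord.tsum hϖ fun h => ?_
  simpa using (ha h).mul (hb (m - h))

/-- The ideal of elements of order at least `k`. -/
def ordIdeal (s : ℕ+) (k : ℕ) : Ideal (annulus p hϖ s) where
  carrier := {a | ∀ m, Ord ϖ s k m (a.1.coeff m)}
  zero_mem' m := Ord.zero s k m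
  add_mem' {a b} ha hb m := by
    have := isUltrametricDist p E
    exact (ha m).add hϖ (hb m)
  smul_mem' c a ha m := by
    have := isUltrametricDist p E
    have h := conv_ord hϖ ((mem_annulus_iff p hϖ).1 c.2) ha m
    rw [zero_add] at h
    exact h

theorem exists_of_ord (hϖ : IsUniformizer ϖ) {s : ℕ+} {k : ℕ} {x : ℤ → E} (hx : ∀ m, Ord ϖ s k m (x m)) :
    ∃ y : ordIdeal p hϖ s k, y.1.1.coeff = x := by
  have h1 : ∀ m, ‖x m‖ ≤ 1 := fun m => by
    obtain ⟨v, hv, -⟩ := hx m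
    exact hv.trans (pow_le_one₀ (norm_nonneg _) hϖ.norm_lt_one.le)
  have h2 : Tendsto x atBot (𝓝 0) := by
    rw [Metric.tendsto_nhds]
    intro ε hε
    obtain ⟨n, hn⟩ := exists_pow_lt_of_lt_one hε hϖ.norm_lt_one
    refine eventually_atBot.2 ⟨-((s : ℕ) * n : ℤ), fun m hm => ?_⟩
    rw [dist_zero_right]
    obtain ⟨v, hv, hv', -⟩ := hx m
    refine (hv.trans (pow_le_pow_of_le_one hϖ.norm_pos.le hϖ.norm_lt_one.le ?_)).trans_lt hn
    have hs : (1 : ℤ) ≤ (s : ℕ) := by exact_mod_cast s.pos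
    have : (n : ℤ) ≤ v := by nlinarith
    exact_mod_cast this
  exact ⟨⟨⟨⟨x, h1, h2⟩, (mem_annulus_iff p hϖ).2 fun m => (hx m).mono ((Nat.zero_le k))⟩, hx⟩, rfl⟩

theorem annulusIdeal_pow (s : ℕ+) (k : ℕ) : annulusIdeal p hϖ s ^ k = ordIdeal p hϖ s k := by
  induction k with
  | zero =>
    rw [pow_zero, Ideal.one_eq_top]
    symm
    rw [Ideal.eq_top_iff_one]
    exact (mem_annulus_iff p hϖ).1 (1 : annulus p hϖ s).2
  | succ k ih =>
    have := isUltrametricDist p E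
    rw [pow_succ, ih]
    apply le_antisymm
    · rw [Ideal.mul_le]
      intro a ha b hb
      have hb' : b ∈ ordIdeal p hϖ s 1 := by
        refine Ideal.span_le.2 ?_ hb
        rintro c (rfl | rfl)
        · exact fun i => monomial_mem p (by simp) (ord_Y s) i
        · exact fun i => monomial_mem p hϖ.norm_lt_one.le (ord_X s) i
      exact fun m => conv_ord hϖ ha hb' m
    · intro a ha
      classical
      have hs : (1 : ℤ) ≤ (s : ℕ) := by exact_mod_cast s.pos
      choose v h1 h2 h3 using ha
      obtain ⟨y, hy⟩ := exists_of_ord p hϖ (s := s) (k := k)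
        (x := fun m => if 1 ≤ m + 1 + s * v (m + 1) then a.1.coeff (m + 1) else 0) (by
          intro m
          split_ifs with h
          · refine ⟨v (m + 1), h1 _, by omega, ?_⟩
            have := h3 (m + 1)
            push_cast at this
            omega
          · exact Ord.zero s k m)
      obtain ⟨z, hz⟩ := exists_of_ord p hϖ (s := s) (k := k)
        (x := fun m => if 1 ≤ m - s + s * v (m - s) then 0 else a.1.coeff (m - s) / ϖ) (by
          intro m
          split_ifs with h
          · exact Ord.zero s k m
          · have a2 := h2 (m - s)
            have a3 := h3 (m - s)
            have e : m - s + (s : ℕ) * (v (m - s) : ℤ) = 0 := by omega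
            rw [e] at a3
            obtain ⟨w, hw⟩ : ∃ w, v (m - s) = w + 1 := by
              refine ⟨v (m - s) - 1, ?_⟩
              push_cast at a3
              omega
            have hn := h1 (m - s)
            rw [hw] at a3 e hn
            push_cast at e a3
            have e' : m + (s : ℕ) * (w : ℤ) = 0 := by linarith
            refine ⟨w, ?_, e'.ge, by omega⟩
            rw [norm_div, div_le_iff₀ hϖ.norm_pos, ← pow_succ]
            exact hn)
      have : a = y.1 * annulusY p hϖ s + z.1 * annulusX p hϖ s := by
        apply Subtype.ext
        apply LaurentHat.ext
        ext m
        have e1 : (y.1 * annulusY p hϖ s : annulus p hϖ s).1.coeff m = y.1.1.coeff (m - 1) := by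
          change conv y.1.1.coeff (Pi.single 1 1) m = _
          rw [conv_comm, single_conv, one_mul]
        have e2 : (z.1 * annulusX p hϖ s : annulus p hϖ s).1.coeff m =
            ϖ * z.1.1.coeff (m + s) := by
          change conv z.1.1.coeff (Pi.single (-(s : ℤ)) ϖ) m = _
          rw [conv_comm, single_conv, sub_neg_eq_add]
        change a.1.coeff m = (y.1 * annulusY p hϖ s : annulus p hϖ s).1.coeff m +
          (z.1 * annulusX p hϖ s : annulus p hϖ s).1.coeff m
        rw [e1, e2, hy, hz]
        simp only [sub_add_cancel, add_sub_cancel_right]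
        split_ifs with h
        · simp
        · rw [zero_add, mul_div_cancel₀ _ hϖ.1]
      rw [this]
      exact add_mem
        (Ideal.mul_mem_mul y.2 (Ideal.subset_span (Set.mem_insert _ _)))
        (Ideal.mul_mem_mul z.2 (Ideal.subset_span (Set.mem_insert_of_mem _ rfl)))

/-- The underlying set of `A_{mv,E}^{†,s}`: the series `∑_n F_n(Y_0) ∏_i (Y_i/Y_0)^{n_i}` with
`F_n ∈ A_E^{(p^{-1/s},1)}` and `F_n → 0` for the `(Y_0, ϖ / Y_0 ^ s)`-adic topology. -/
def AmvDaggerSet (f : ℕ) (s : ℕ+) : Set (Amv p E f) :=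
  {a | ∃ h : ∀ n, a.coeff n ∈ annulus p hϖ s, ∀ k : ℕ, ∀ᶠ n in cofinite,
    (⟨a.coeff n, h n⟩ : annulus p hϖ s) ∈ annulusIdeal p hϖ s ^ k}

theorem mem_AmvDaggerSet_iff {f : ℕ} {s : ℕ+} {a : Amv p E f} :
    a ∈ AmvDaggerSet p hϖ f s ↔ (∀ n m, Ord ϖ s 0 m ((a.coeff n).coeff m)) ∧
      ∀ k : ℕ, ∀ᶠ n in cofinite, ∀ m, Ord ϖ s k m ((a.coeff n).coeff m) := by
  simp only [AmvDaggerSet, annulusIdeal_pow]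
  constructor
  · rintro ⟨h, h'⟩
    exact ⟨fun n => (mem_annulus_iff p hϖ).1 (h n), h'⟩
  · rintro ⟨h, h'⟩
    exact ⟨fun n => (mem_annulus_iff p hϖ).2 (h n), h'⟩

/-- The ring `A_{mv,E}^{†,s}`, as a subring of `A_{mv,E}`. -/
def AmvDaggerS (f : ℕ) (s : ℕ+) : Subring (Amv p E f) where
  carrier := AmvDaggerSet p hϖ f s
  zero_mem' := (mem_AmvDaggerSet_iff p hϖ).2
    ⟨fun _ m => Ord.zero s 0 m, fun k => Eventually.of_forall fun _ m => Ord.zero s k m⟩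
  one_mem' := by
    have h : ∀ n m, Ord ϖ s 0 m (((1 : Amv p E f).coeff n).coeff m) := by
      intro n m
      change Ord ϖ s 0 m ((Pi.single 0 1 : (Fin (f - 1) → ℤ) × ℤ → E) (n, m))
      by_cases h : (n, m) = 0
      · rw [h, Pi.single_eq_same]
        obtain ⟨rfl, rfl⟩ := Prod.mk_eq_zero.1 h
        exact ⟨0, by simp⟩
      · rw [Pi.single_eq_of_ne h]
        exact Ord.zero s 0 m
    refine (mem_AmvDaggerSet_iff p hϖ).2 ⟨h, fun k => ?_⟩
    refine (Set.finite_singleton 0).subset fun n hn => ?_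
    by_contra hn0
    refine hn fun m => ?_
    change Ord ϖ s k m ((Pi.single 0 1 : (Fin (f - 1) → ℤ) × ℤ → E) (n, m))
    rw [Pi.single_eq_of_ne fun h => hn0 (Prod.mk_eq_zero.1 h).1]
    exact Ord.zero s k m
  neg_mem' {a} ha := by
    rw [mem_AmvDaggerSet_iff] at ha ⊢
    exact ⟨fun n m => (ha.1 n m).neg, fun k => (ha.2 k).mono fun n hn m => (hn m).neg⟩
  add_mem' {a b} ha hb := by
    have := isUltrametricDist p E
    rw [mem_AmvDaggerSet_iff] at ha hb ⊢
    exact ⟨fun n m => (ha.1 n m).add hϖ (hb.1 n m), fun k => by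
      filter_upwards [ha.2 k, hb.2 k] with n h1 h2 m using (h1 m).add hϖ (h2 m)⟩
  mul_mem' {a b} ha hb := by
    have := isUltrametricDist p E
    rw [mem_AmvDaggerSet_iff] at ha hb ⊢
    refine ⟨fun n m => Ord.tsum hϖ fun h => ?_, fun k => ?_⟩
    · simpa [Amv.fn] using (ha.1 h.1 h.2).mul (hb.1 (n - h.1) (m - h.2))
    · have fa : {n | ¬ ∀ m, Ord ϖ s k m ((a.coeff n).coeff m)}.Finite := ha.2 k
      have fb : {n | ¬ ∀ m, Ord ϖ s k m ((b.coeff n).coeff m)}.Finite := hb.2 k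
      refine ((fa.prod fb).image fun u => u.1 + u.2).subset ?_
      intro n hn
      by_contra H
      refine hn fun m => Ord.tsum hϖ fun h => ?_
      by_cases h1 : ∀ m, Ord ϖ s k m ((a.coeff h.1).coeff m)
      · simpa [Amv.fn] using (h1 h.2).mul (hb.1 (n - h.1) (m - h.2))
      by_cases h2 : ∀ m, Ord ϖ s k m ((b.coeff (n - h.1)).coeff m)
      · simpa [Amv.fn] using (ha.1 h.1 h.2).mul (h2 (m - h.2))
      · exact absurd ⟨(h.1, n - h.1), ⟨h1, h2⟩, by simp⟩ H

theorem Ord.mono_radius {s t : ℕ+} (hst : s ≤ t) {k : ℕ} {m : ℤ} {x : E} (h : Ord ϖ s k m x) :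
    Ord ϖ t k m x := by
  obtain ⟨v, h1, h2, h3⟩ := h
  have hst' : ((s : ℕ) : ℤ) ≤ (t : ℕ) := by exact_mod_cast hst
  have : ((s : ℕ) : ℤ) * v ≤ (t : ℕ) * v := mul_le_mul_of_nonneg_right hst' (Int.natCast_nonneg v)
  exact ⟨v, h1, by omega, by omega⟩

theorem AmvDaggerS_mono (f : ℕ) {s t : ℕ+} (hst : s ≤ t) :
    AmvDaggerS p hϖ f s ≤ AmvDaggerS p hϖ f t := by
  intro a ha
  obtain ⟨h1, h2⟩ := (mem_AmvDaggerSet_iff p hϖ).1 ha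
  exact (mem_AmvDaggerSet_iff p hϖ).2 ⟨fun n m => (h1 n m).mono_radius hst,
    fun k => (h2 k).mono fun n hn m => (hn m).mono_radius hst⟩

/-- The ring `A_{mv,E}^{†,∞}`, the union of the subrings `A_{mv,E}^{†,s}` for `s ≥ 1`. -/
def AmvDaggerInf (f : ℕ) : Subring (Amv p E f) where
  carrier := ⋃ s : ℕ+, (AmvDaggerS p hϖ f s : Set (Amv p E f))
  zero_mem' := Set.mem_iUnion.2 ⟨1, zero_mem _⟩
  one_mem' := Set.mem_iUnion.2 ⟨1, one_mem _⟩
  neg_mem' {a} ha := by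
    obtain ⟨s, hs⟩ := Set.mem_iUnion.1 ha
    exact Set.mem_iUnion.2 ⟨s, neg_mem hs⟩
  add_mem' {a b} ha hb := by
    obtain ⟨s, hs⟩ := Set.mem_iUnion.1 ha
    obtain ⟨t, ht⟩ := Set.mem_iUnion.1 hb
    exact Set.mem_iUnion.2 ⟨max s t, add_mem (AmvDaggerS_mono p hϖ f (le_max_left s t) hs)
      (AmvDaggerS_mono p hϖ f (le_max_right s t) ht)⟩
  mul_mem' {a b} ha hb := by
    obtain ⟨s, hs⟩ := Set.mem_iUnion.1 ha
    obtain ⟨t, ht⟩ := Set.mem_iUnion.1 hb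
    exact Set.mem_iUnion.2 ⟨max s t, mul_mem (AmvDaggerS_mono p hϖ f (le_max_left s t) hs)
      (AmvDaggerS_mono p hϖ f (le_max_right s t) ht)⟩

/-- The variable `Y_0` as a unit of `A_{mv,E}`. -/
noncomputable def Amv.Y₀ (E : Type*) [NormedField E] [NormedAlgebra ℚ_[p] E]
    [FiniteDimensional ℚ_[p] E] (f : ℕ) : (Amv p E f)ˣ where
  val := .mk' (Pi.single (0, 1) 1) (Good.single _ (by simp))
  inv := .mk' (Pi.single (0, -1) 1) (Good.single _ (by simp))
  val_inv := by
    apply Amv.fn_injective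
    ext u
    simp only [Amv.fn_mul, Amv.fn_mk', single_conv, one_mul, Amv.fn_one, Pi.single_apply]
    simp [sub_eq_iff_eq_add, Prod.mk_zero_zero]
  inv_val := by
    apply Amv.fn_injective
    ext u
    simp only [Amv.fn_mul, Amv.fn_mk', single_conv, one_mul, Amv.fn_one, Pi.single_apply]
    simp [sub_eq_iff_eq_add, Prod.mk_zero_zero]

theorem Amv.Y₀_mem (f : ℕ) : (Amv.Y₀ p E f : Amv p E f) ∈ AmvDaggerInf p hϖ f := by
  refine Set.mem_iUnion.2 ⟨1, (mem_AmvDaggerSet_iff p hϖ).2 ⟨fun n m => ?_, fun k => ?_⟩⟩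
  · change Ord ϖ 1 0 m ((Pi.single (0, 1) 1 : (Fin (f - 1) → ℤ) × ℤ → E) (n, m))
    by_cases h : (n, m) = (0, 1)
    · rw [h, Pi.single_eq_same]
      obtain ⟨rfl, rfl⟩ := Prod.mk.inj h
      exact ⟨0, by simp⟩
    · rw [Pi.single_eq_of_ne h]
      exact Ord.zero _ 0 m
  · refine (Set.finite_singleton 0).subset fun n hn => ?_
    by_contra hn0
    refine hn fun m => ?_
    change Ord ϖ 1 k m ((Pi.single (0, 1) 1 : (Fin (f - 1) → ℤ) × ℤ → E) (n, m))
    rw [Pi.single_eq_of_ne fun h => hn0 (Prod.mk.inj h).1]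
    exact Ord.zero _ k m

/-- The ring `A_{mv,E}^† = A_{mv,E}^{†,∞}[1/Y_0]`, as a subring of `A_{mv,E}`: its elements are the
`y / Y_0 ^ k` with `y ∈ A_{mv,E}^{†,∞}` and `k ≥ 0`. -/
noncomputable def AmvDagger (f : ℕ) : Subring (Amv p E f) where
  carrier := {a | ∃ k : ℕ, ∃ y ∈ AmvDaggerInf p hϖ f, a = y * (↑(Amv.Y₀ p E f)⁻¹ : Amv p E f) ^ k}
  zero_mem' := ⟨0, 0, zero_mem _, by simp⟩
  one_mem' := ⟨0, 1, one_mem _, by simp⟩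
  neg_mem' := by
    rintro _ ⟨k, y, hy, rfl⟩
    exact ⟨k, -y, neg_mem hy, by ring⟩
  add_mem' := by
    rintro _ _ ⟨k, y, hy, rfl⟩ ⟨l, z, hz, rfl⟩
    refine ⟨k + l, y * (Amv.Y₀ p E f : Amv p E f) ^ l + z * (Amv.Y₀ p E f : Amv p E f) ^ k,
      add_mem (mul_mem hy (pow_mem (Amv.Y₀_mem p hϖ f) l))
        (mul_mem hz (pow_mem (Amv.Y₀_mem p hϖ f) k)), ?_⟩
    have h : ∀ n, (Amv.Y₀ p E f : Amv p E f) ^ n * (↑(Amv.Y₀ p E f)⁻¹ : Amv p E f) ^ n = 1 := by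
      intro n
      rw [← mul_pow, Units.mul_inv, one_pow]
    rw [pow_add]
    linear_combination (-y * (↑(Amv.Y₀ p E f)⁻¹ : Amv p E f) ^ k) * h l -
      (z * (↑(Amv.Y₀ p E f)⁻¹ : Amv p E f) ^ l) * h k
  mul_mem' := by
    rintro _ _ ⟨k, y, hy, rfl⟩ ⟨l, z, hz, rfl⟩
    exact ⟨k + l, y * z, mul_mem hy hz, by ring⟩

end Dagger

end MvPhiGamma

/-!
Write `A` for `A_{mv,E}` and `A^{†,s}` for `A_{mv,E}^{†,s}`, and put `X = ϖ / Y_{σ₀}^s` and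
`Y = Y_{σ₀}`. The ring `A^{†,s}` is `X`-adically complete, its quotient by `X` is `Y`-adically
complete, and modulo `X` and `Y` every element is a Laurent polynomial over `𝒪_E` in the `U_i`, so
`A^{†,s}` is Noetherian. Every element of `A` is congruent modulo `ϖ` to an element of
`A^{†,s}[1/Y]`, and `A^{†,s}[1/Y] ∩ ϖA = ϖA^{†,s}[1/Y]`. As `A` is `ϖ`-adically complete, it is
therefore the `ϖ`-adic completion of the Noetherian ring `A^{†,s}[1/Y]`, hence flat over it.
Flatness over `A^{†,∞}` and `A^†` follows by localization and passage to the union over `s`.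

For `y ∈ A^†` and `r` large, `Y^r y ∈ A^{†,r}`, so that `1 + ϖy = 1 + (ϖ/Y^r)(Y^r y)` is a unit of
the `ϖ/Y^r`-adically complete ring `A^{†,r}`. Hence `ϖ` lies in the Jacobson radical of `A^†`, and
since `A^†/ϖ = A/ϖ`, no maximal ideal of `A^†` generates the unit ideal of `A`.
-/

namespace MvPhiGamma

open Filter

section CommutativeAlgebra

section Adic

variable {R M : Type*} [CommRing R] [AddCommGroup M] [Module R M] {x : R}

theorem mem_span_singleton_pow_smul_top {n : ℕ} {a : M} :
    a ∈ (Ideal.span {x} ^ n • ⊤ : Submodule R M) ↔ ∃ b : M, x ^ n • b = a := by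
  rw [Ideal.span_singleton_pow, Submodule.ideal_span_singleton_smul,
    Submodule.mem_smul_pointwise_iff_exists]
  simp only [Submodule.mem_top, true_and]

theorem isHausdorff_span_singleton (h : ∀ a : M, (∀ n : ℕ, ∃ b : M, x ^ n • b = a) → a = 0) :
    IsHausdorff (Ideal.span {x}) M :=
  ⟨fun a ha => h a fun n => mem_span_singleton_pow_smul_top.1 (SModEq.zero.1 (ha n))⟩

/-- `F c` plays the role of the sum of the series `∑ xⁿ • cₙ`. -/
theorem isPrecomplete_span_singleton (F : (ℕ → M) → M)
    (hF : ∀ c, F c = c 0 + x • F fun i => c (i + 1)) : IsPrecomplete (Ideal.span {x}) M := by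
  have F_sub_sum_mem (c : ℕ → M) (n : ℕ) :
      ∃ b, x ^ n • b = F c - ∑ i ∈ Finset.range n, x ^ i • c i := by
    refine ⟨F fun i => c (n + i), ?_⟩
    induction n with
    | zero => simp
    | succ n ih =>
      rw [hF] at ih
      rw [Finset.sum_range_succ, ← sub_sub, ← ih]
      simp only [add_zero, smul_add, smul_smul, ← pow_succ, add_sub_cancel_left, ← add_assoc,
        add_right_comm n _ 1]
  refine ⟨fun u hu => ?_⟩
  choose c hc using fun n : ℕ =>
    mem_span_singleton_pow_smul_top.1 (SModEq.sub_mem.1 (hu n.le_succ))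
  have sum_eq (n : ℕ) : ∑ i ∈ Finset.range n, x ^ i • c i = u 0 - u n := by
    simp only [hc, Finset.sum_range_sub']
  refine ⟨u 0 - F c, fun n => SModEq.sub_mem.2 (mem_span_singleton_pow_smul_top.2 ?_)⟩
  obtain ⟨b, hb⟩ := F_sub_sum_mem c n
  exact ⟨b, by rw [hb, sum_eq]; abel⟩

variable {N : Type*} [AddCommGroup N] [Module R N] {I : Ideal R}

theorem isHausdorff_of_injective {f : N →ₗ[R] M} (hf : Function.Injective f) [IsHausdorff I M] :
    IsHausdorff I N :=
  ⟨fun a ha => hf <| by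
    rw [map_zero]
    refine IsHausdorff.haus ‹_› _ fun n => SModEq.zero.2 ?_
    exact Submodule.smul_top_le_comap_smul_top _ f (SModEq.zero.1 (ha n))⟩

theorem isPrecomplete_of_surjective {f : M →ₗ[R] N} (hf : Function.Surjective f)
    [IsPrecomplete I M] : IsPrecomplete I N := by
  refine AdicCompletion.of_surjective_iff.1 fun b => ?_
  obtain ⟨a, rfl⟩ := AdicCompletion.map_surjective I hf b
  obtain ⟨a, rfl⟩ := AdicCompletion.of_surjective I M a
  exact ⟨f a, (AdicCompletion.map_of I f a).symm⟩

theorem isPrecomplete_pi {ι : Type*} [Finite ι] [IsPrecomplete I M] :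
    IsPrecomplete I (ι → M) := by
  have := Fintype.ofFinite ι
  classical
  refine AdicCompletion.of_surjective_iff.1 fun b => ?_
  choose a ha using fun i =>
    AdicCompletion.of_surjective I M (AdicCompletion.piEquivOfFintype I (fun _ : ι => M) b i)
  refine ⟨a, (AdicCompletion.piEquivOfFintype I fun _ : ι => M).injective (funext fun i => ?_)⟩
  rw [← ha]
  rfl

theorem finite_of_isPrecomplete_of_isHausdorff [IsPrecomplete I R] [IsHausdorff I M]
    [Module.Finite R (M ⧸ (I • ⊤ : Submodule R M))] : Module.Finite R M := by
  obtain ⟨n, g, hg⟩ := Module.Finite.exists_fin' R (M ⧸ (I • ⊤ : Submodule R M))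
  obtain ⟨h, rfl⟩ := Module.projective_lifting_property _ g (Submodule.mkQ_surjective (I • ⊤))
  have : IsPrecomplete I (Fin n → R) := isPrecomplete_pi
  exact .of_surjective h (surjective_of_mkQ_comp_surjective hg)

/-- It suffices that primes `P` are finitely generated. If `x ∈ P`, this can be checked modulo `x`.
If `x ∉ P`, then `P / xP` is a submodule of `R / x`, so that `P` is finitely generated because it is
`x`-adically separated. -/
theorem isNoetherianRing_of_isAdicComplete (x : R) [IsAdicComplete (Ideal.span {x}) R]
    [IsNoetherianRing (R ⧸ Ideal.span {x})] : IsNoetherianRing R := by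
  have : IsNoetherian R (R ⧸ Ideal.span {x}) :=
    isNoetherian_mk ⟨(Submodule.orderIsoOfAlgebraMapSurjective (M := R ⧸ Ideal.span {x})
      Ideal.Quotient.mk_surjective).symm.toOrderEmbedding.dual.wellFounded (IsNoetherian.wf ‹_›)⟩
  refine .of_prime fun P hP => ?_
  by_cases hx : x ∈ P
  · refine Submodule.fg_of_fg_map_of_fg_inf_ker (Ideal.span {x}).mkQ (IsNoetherian.noetherian _) ?_
    rw [Submodule.ker_mkQ, inf_eq_right.2 ((Ideal.span_singleton_le_iff_mem _).2 hx)]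
    exact Submodule.fg_span_singleton x
  have hle : Ideal.span {x} • ⊤ ≤ Submodule.comap P.subtype (Ideal.span {x}) := by
    simpa using Submodule.smul_top_le_comap_smul_top (Ideal.span {x}) P.subtype
  have mapQ_injective : Function.Injective (Submodule.mapQ _ _ P.subtype hle) := by
    rw [← LinearMap.ker_eq_bot, Submodule.mapQ, Submodule.ker_liftQ_eq_bot]
    intro a ha
    obtain ⟨b, hb⟩ := Ideal.mem_span_singleton'.1 ((Submodule.Quotient.mk_eq_zero _).1 ha)
    have hbP : b ∈ P := (hP.mem_or_mem (hb ▸ a.2 : b * x ∈ P)).resolve_right hx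
    convert Submodule.smul_mem_smul (Ideal.mem_span_singleton_self x)
      (Submodule.mem_top (R := R) (x := (⟨b, hbP⟩ : P)))
    exact Subtype.ext (hb.symm.trans (mul_comm b x))
  have : Module.Finite R (P ⧸ (Ideal.span {x} • ⊤ : Submodule R P)) :=
    .of_injective _ mapQ_injective
  have : IsHausdorff (Ideal.span {x}) P := isHausdorff_of_injective P.injective_subtype
  exact Module.Finite.iff_fg.1 (finite_of_isPrecomplete_of_isHausdorff (I := Ideal.span {x}))

theorem isNoetherianRing_of_isAdicComplete_pair (x y : R) [IsAdicComplete (Ideal.span {x}) R]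
    [IsPrecomplete (Ideal.span {y}) R] [IsHausdorff (Ideal.span {y}) (R ⧸ Ideal.span {x})]
    [IsNoetherianRing (R ⧸ Ideal.span {x} ⊔ Ideal.span {y})] : IsNoetherianRing R := by
  have : IsPrecomplete (Ideal.span {y}) (R ⧸ Ideal.span {x}) :=
    isPrecomplete_of_surjective (Submodule.mkQ_surjective (Ideal.span {x}))
  have map_span : (Ideal.span {y}).map (Ideal.Quotient.mk (Ideal.span {x})) =
      Ideal.span {Ideal.Quotient.mk (Ideal.span {x}) y} := by
    rw [Ideal.map_span, Set.image_singleton]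
  have : IsAdicComplete (Ideal.span {Ideal.Quotient.mk (Ideal.span {x}) y})
      (R ⧸ Ideal.span {x}) := by
    rw [← map_span]
    exact (IsAdicComplete.map_algebraMap_iff _ _).2 ⟨⟩
  have : IsNoetherianRing
      ((R ⧸ Ideal.span {x}) ⧸ Ideal.span {Ideal.Quotient.mk (Ideal.span {x}) y}) := by
    rw [← map_span]
    exact isNoetherianRing_of_ringEquiv _
      (DoubleQuot.quotQuotEquivQuotSup (Ideal.span {x}) (Ideal.span {y})).symm
  have := isNoetherianRing_of_isAdicComplete (Ideal.Quotient.mk (Ideal.span {x}) y)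
  exact isNoetherianRing_of_isAdicComplete x

theorem adicCompletion_map_injective {f : M →ₗ[R] N}
    (h : ∀ n : ℕ, (I ^ n • ⊤ : Submodule R N).comap f ≤ I ^ n • ⊤) :
    Function.Injective (AdicCompletion.map I f) := by
  refine (injective_iff_map_eq_zero _).2 fun a ha => ?_
  ext n
  obtain ⟨a, rfl⟩ := AdicCompletion.mk_surjective I M a
  have := congrArg (AdicCompletion.eval I N n) ha
  rw [AdicCompletion.map_mk] at this
  have map_mem : f (a n) ∈ (I ^ n • ⊤ : Submodule R N) := (Submodule.Quotient.mk_eq_zero _).1 this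
  exact (Submodule.Quotient.mk_eq_zero _).2 (h n map_mem)

theorem flat_of_isAdicComplete [IsNoetherianRing R] [IsAdicComplete I M] (f : R →ₗ[R] M)
    (hinj : ∀ n : ℕ, (I ^ n • ⊤ : Submodule R M).comap f ≤ I ^ n • ⊤)
    (hsurj : Function.Surjective ((I • ⊤ : Submodule R M).mkQ ∘ₗ f)) : Module.Flat R M := by
  have : Module.Flat R (AdicCompletion I R) := AdicCompletion.flat_of_isNoetherian I
  have : Module.Flat R (AdicCompletion I M) :=
    .of_linearEquiv ((LinearEquiv.ofBijective (AdicCompletion.map I f)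
      ⟨adicCompletion_map_injective hinj,
        AdicCompletion.map_surjective_of_mkQ_comp_surjective hsurj⟩).symm.restrictScalars R)
  exact .of_linearEquiv (AdicCompletion.ofLinearEquiv I M)

theorem mem_range_of_pow_smul_mem_range {f : N →ₗ[R] M}
    (hsat : ∀ a, x • a ∈ f.range → a ∈ f.range) (n : ℕ) {a : M} (ha : x ^ n • a ∈ f.range) :
    a ∈ f.range := by
  induction n with
  | zero => simpa using ha
  | succ n ih => exact ih (hsat _ (by rwa [smul_smul, ← pow_succ']))

theorem flat_of_isAdicComplete_span_singleton [IsNoetherianRing R]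
    [IsAdicComplete (Ideal.span {x}) M] {f : R →ₗ[R] M} (hf : Function.Injective f)
    (hsat : ∀ a, x • a ∈ f.range → a ∈ f.range) (happrox : ∀ a, ∃ b c, a = f b + x • c) :
    Module.Flat R M := by
  refine flat_of_isAdicComplete (I := Ideal.span {x}) f (fun n b hb => ?_) fun a => ?_
  · obtain ⟨a, ha⟩ := mem_span_singleton_pow_smul_top.1 hb
    obtain ⟨c, rfl⟩ := mem_range_of_pow_smul_mem_range hsat n (a := a) ⟨b, ha.symm⟩
    exact mem_span_singleton_pow_smul_top.2 ⟨c, hf (by rw [map_smul, ha])⟩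
  · obtain ⟨a, rfl⟩ := Submodule.mkQ_surjective _ a
    obtain ⟨b, c, rfl⟩ := happrox a
    refine ⟨b, (Submodule.Quotient.eq _).2 ?_⟩
    rw [sub_add_cancel_left, neg_mem_iff]
    exact Submodule.smul_mem_smul (Ideal.mem_span_singleton_self x) Submodule.mem_top

theorem faithfullyFlat_of_mem_jacobson [Module.Flat R M] {f : R →ₗ[R] M}
    (hf : Function.Injective f) (hx : x ∈ Ideal.jacobson (⊥ : Ideal R))
    (hsat : ∀ a, x • a ∈ f.range → a ∈ f.range) (happrox : ∀ a, ∃ b c, a = f b + x • c) :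
    Module.FaithfullyFlat R M where
  submodule_ne_top 𝔪 h𝔪 htop := by
    have exists_of_mem (a : M) (ha : a ∈ 𝔪 • (⊤ : Submodule R M)) :
        ∃ b ∈ 𝔪, ∃ c, a = f b + x • c := by
      refine Submodule.smul_induction_on ha (fun r hr a _ => ?_) ?_
      · obtain ⟨b, c, rfl⟩ := happrox a
        exact ⟨r * b, 𝔪.mul_mem_right b hr, r • c, by
          rw [smul_add, smul_comm r x, ← smul_eq_mul, map_smul]⟩
      · rintro _ _ ⟨b, hb, c, rfl⟩ ⟨b', hb', c', rfl⟩
        exact ⟨b + b', add_mem hb hb', c + c', by rw [map_add, smul_add, add_add_add_comm]⟩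
    obtain ⟨b, hb, c, hbc⟩ := exists_of_mem (f 1) (htop.ge Submodule.mem_top)
    obtain ⟨d, rfl⟩ := hsat c ⟨1 - b, by rw [map_sub, hbc, add_sub_cancel_left]⟩
    have one_eq : 1 = b + x * d := hf (by rw [hbc, map_add, ← smul_eq_mul x, map_smul])
    have x_mem : x ∈ 𝔪 := Ideal.mem_sInf.1 hx ⟨bot_le, h𝔪⟩
    exact h𝔪.ne_top ((Ideal.eq_top_iff_one _).2
      (one_eq ▸ add_mem hb (𝔪.mul_mem_right d x_mem)))

end Adic

section Subrings

variable {A : Type*} [CommRing A]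

/-- Only finitely many coefficients occur in a linear relation. -/
theorem flat_iSup_of_directed {ι : Type*} [Nonempty ι] {S : ι → Subring A}
    (hS : Directed (· ≤ ·) S) (h : ∀ i, Module.Flat (S i) A) :
    Module.Flat (⨆ i, S i : Subring A) A := by
  refine Module.Flat.iff_forall_isTrivialRelation.2 fun {l r a} hra => ?_
  classical
  choose i hi using fun j => (Subring.mem_iSup_of_directed hS).1 (r j).2
  obtain ⟨i₀, hi₀⟩ := hS.finset_le (Finset.univ.image i)
  have hr (j) : (r j : A) ∈ S i₀ := hi₀ _ (Finset.mem_image_of_mem i (Finset.mem_univ j)) (hi j)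
  obtain ⟨k, b, y, hay, hrb⟩ := Module.Flat.iff_forall_isTrivialRelation.1 (h i₀)
    (f := fun j => ⟨r j, hr j⟩) (x := a) hra
  have hle : S i₀ ≤ ⨆ i, S i := le_iSup S i₀
  refine ⟨k, fun j m => ⟨b j m, hle (b j m).2⟩, y, hay, fun m => Subtype.ext ?_⟩
  simpa using congrArg Subtype.val (hrb m)

variable (B : Subring A) (y : Aˣ) (hy : (y : A) ∈ B)

/-- The subring `B[1 / y]` of `A`, for a subring `B` of `A` and an element `y` of `B` which is a
unit of `A`. -/
def adjoinInv : Subring A where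
  carrier := {a | ∃ k : ℕ, (y : A) ^ k * a ∈ B}
  zero_mem' := ⟨0, by simp⟩
  one_mem' := ⟨0, by simp⟩
  neg_mem' := fun ⟨k, hk⟩ => ⟨k, by simpa using hk⟩
  add_mem' {a b} := fun ⟨k, hk⟩ ⟨l, hl⟩ => ⟨k + l, by
    rw [show (y : A) ^ (k + l) * (a + b) = y ^ l * (y ^ k * a) + y ^ k * (y ^ l * b) by ring]
    exact add_mem (mul_mem (pow_mem hy l) hk) (mul_mem (pow_mem hy k) hl)⟩
  mul_mem' {a b} := fun ⟨k, hk⟩ ⟨l, hl⟩ => ⟨k + l, by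
    rw [pow_add, mul_mul_mul_comm]
    exact mul_mem hk hl⟩

variable {B y}

theorem le_adjoinInv : B ≤ adjoinInv B y hy := fun _ ha => ⟨0, by simpa using ha⟩

instance : Algebra B (adjoinInv B y hy) := (Subring.inclusion (le_adjoinInv hy)).toAlgebra

instance : IsScalarTower B (adjoinInv B y hy) A := .of_algebraMap_eq fun _ => rfl

instance isLocalization_adjoinInv :
    IsLocalization.Away (⟨y, hy⟩ : B) (adjoinInv B y hy) := by
  have inv_mem : (↑y⁻¹ : A) ∈ adjoinInv B y hy := ⟨1, by simp⟩
  refine .mk _ (.of_mul_eq_one ⟨_, inv_mem⟩ (Subtype.ext y.mul_inv)) ?_ ?_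
  · rintro ⟨a, k, hk⟩
    exact ⟨k, ⟨_, hk⟩, Subtype.ext (mul_comm _ _)⟩
  · exact fun a b hab => ⟨0, congrArg _ (Subtype.ext (congrArg Subtype.val hab :))⟩

theorem isNoetherianRing_adjoinInv [IsNoetherianRing B] : IsNoetherianRing (adjoinInv B y hy) :=
  IsLocalization.isNoetherianRing (.powers (⟨y, hy⟩ : B)) (adjoinInv B y hy) ‹_›

theorem flat_adjoinInv_iff : Module.Flat (adjoinInv B y hy) A ↔ Module.Flat B A :=
  Module.flat_iff_of_isLocalization _ (.powers (⟨y, hy⟩ : B)) A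

end Subrings
end CommutativeAlgebra

section IntegerRing

open scoped NormedField in
theorem isNoetherianRing_integer (E : Type*) [NormedField E] [IsUltrametricDist E] [ProperSpace E] :
    IsNoetherianRing (NormedField.valuation (K := E)).integer := by
  have : CompactSpace (NormedField.valuation (K := E)).integer := by
    refine isCompact_iff_compactSpace.1
      (?_ : IsCompact ((NormedField.valuation (K := E)).integer : Set E))
    convert isCompact_closedBall (0 : E) 1 using 1
    ext x
    simp [Valuation.mem_integer_iff, ← NNReal.coe_le_coe]
  have := Valued.integer.isPrincipalIdealRing_of_compactSpace (K := E)
  exact inferInstanceAs (IsNoetherianRing (Valued.v (R := E)).integer)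

end IntegerRing

section Order

variable {E : Type*} [NormedField E] {ϖ x y : E} {s : ℕ+} {k : ℕ} {m : ℤ}

theorem Ord.of_norm_le (hx : Ord ϖ s k m x) (h : ‖y‖ ≤ ‖x‖) : Ord ϖ s k m y := by
  obtain ⟨v, hv, hkm⟩ := hx
  exact ⟨v, h.trans hv, hkm⟩

theorem Ord.of_le (hx : ‖x‖ ≤ 1) (h : (k : ℤ) ≤ m) : Ord ϖ s k m x :=
  ⟨0, by simpa using hx, by push_cast; omega, by push_cast; omega⟩

theorem Ord.norm_le_one (hϖ : IsUniformizer ϖ) (hx : Ord ϖ s k m x) : ‖x‖ ≤ 1 := by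
  obtain ⟨v, hv, -⟩ := hx
  exact hv.trans (pow_le_one₀ (norm_nonneg _) hϖ.norm_lt_one.le)

theorem Ord.le_of_norm_lt (hϖ : IsUniformizer ϖ) (h : Ord ϖ s k m x) (hx : ‖ϖ‖ < ‖x‖) :
    (k : ℤ) ≤ m := by
  obtain ⟨v, hv, -, hkm⟩ := h
  obtain rfl : v = 0 := by
    by_contra hv0
    exact hx.not_ge (hv.trans (pow_le_of_le_one hϖ.norm_pos.le hϖ.norm_lt_one.le hv0))
  simpa using hkm

theorem Ord.of_uniformizer_mul (hϖ : IsUniformizer ϖ) (h : Ord ϖ s k m (ϖ * x)) (hx : ‖x‖ ≤ 1) :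
    Ord ϖ s (k - 1) (m + s) x := by
  obtain ⟨v, hv, hm, hkm⟩ := h
  cases v with
  | zero =>
    have := s.pos
    exact ⟨0, by simpa using hx, by push_cast at *; omega, by push_cast at *; omega⟩
  | succ v =>
    rw [norm_mul, pow_succ'] at hv
    push_cast [mul_add] at hm hkm
    exact ⟨v, le_of_mul_le_mul_left hv hϖ.norm_pos, by omega, by omega⟩

theorem Ord.exists_norm_lt (hϖ : IsUniformizer ϖ) (s : ℕ+) (m : ℤ) {ε : ℝ} (hε : 0 < ε) :
    ∃ k : ℕ, ∀ m' ≤ m, ∀ x : E, Ord ϖ s k m' x → ‖x‖ < ε := by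
  obtain ⟨N, hN⟩ := exists_pow_lt_of_lt_one hε hϖ.norm_lt_one
  refine ⟨m.natAbs + (s + 1) * N, fun m' hm x ⟨v, hv, _, hkm⟩ => ?_⟩
  refine (hv.trans (pow_le_pow_of_le_one hϖ.norm_pos.le hϖ.norm_lt_one.le ?_)).trans_lt hN
  push_cast at hkm
  have mul_le : ((s : ℕ) + 1 : ℤ) * N ≤ ((s : ℕ) + 1) * v := by linarith [le_abs_self m]
  exact_mod_cast le_of_mul_le_mul_left mul_le (by positivity)

theorem Ord.eq_zero (hϖ : IsUniformizer ϖ) (h : ∀ k, Ord ϖ s k m x) : x = 0 := by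
  by_contra hx
  obtain ⟨k, hk⟩ := Ord.exists_norm_lt hϖ s m (norm_pos_iff.2 hx)
  exact lt_irrefl _ (hk m le_rfl x (h k))

end Order

section Coefficients

variable {E : Type*} [NormedField E]

section

variable {G : Type*} [AddCommGroup G] {deg : G →+ ℤ}

theorem Good.indicator {x : G → E} (hx : Good deg x) (T : Set G) : Good deg (T.indicator x) where
  le_one g := (norm_indicator_le_norm_self x g).trans (hx.le_one g)
  finite ε hε N := (hx.finite ε hε N).subset fun g hg =>
    ⟨hg.1, hg.2.trans (norm_indicator_le_norm_self x g)⟩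

theorem Good.tsum [IsUltrametricDist E] {x : ℕ → G → E} (hx : ∀ i, Good deg (x i))
    (h : ∀ ε > 0, ∃ k, ∀ i ≥ k, ∀ g, ‖x i g‖ < ε) : Good deg fun g => ∑' i, x i g where
  le_one g := norm_tsum_le_of zero_le_one fun i => (hx i).le_one g
  finite ε hε N := by
    obtain ⟨k, hk⟩ := h _ (half_pos hε)
    refine ((Set.finite_Iio k).biUnion fun i _ => (hx i).finite _ (half_pos hε) N).subset ?_
    rintro g ⟨hgN, hg⟩
    obtain ⟨i, hi⟩ : ∃ i, ε / 2 ≤ ‖x i g‖ := by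
      by_contra! hlt
      exact (half_lt_self hε).not_ge
        (hg.trans (norm_tsum_le_of (half_pos hε).le fun i => (hlt i).le))
    exact Set.mem_biUnion (not_le.1 fun hki => (hk i hki g).not_ge hi : i < k) ⟨hgN, hi⟩

end

variable {L : Type*} {ϖ : E} {s : ℕ+} {x : L × ℤ → E}

/-- The conditions on the coefficients of an element of `A_{mv,E}` which cut out
`A_{mv,E}^{†,s}`. -/
structure Overconvergent (ϖ : E) (s : ℕ+) (x : L × ℤ → E) : Prop where
  ord : ∀ g, Ord ϖ s 0 g.2 (x g)
  eventually : ∀ k : ℕ, ∀ᶠ n in cofinite, ∀ m, Ord ϖ s k m (x (n, m))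

theorem Overconvergent.good [AddCommGroup L] (hϖ : IsUniformizer ϖ) (hx : Overconvergent ϖ s x) :
    Good (degY L) x where
  le_one g := (hx.ord g).norm_le_one hϖ
  finite ε hε N := by
    obtain ⟨k, hk⟩ := Ord.exists_norm_lt hϖ s N hε
    obtain ⟨M, hM⟩ := exists_pow_lt_of_lt_one hε hϖ.norm_lt_one
    have hfin : {n | ¬ ∀ m, Ord ϖ s k m (x (n, m))}.Finite := hx.eventually k
    refine (hfin.prod (Set.finite_Ico (-((s : ℕ) * M : ℤ)) N)).subset ?_
    rintro ⟨n, m⟩ ⟨hm, hn⟩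
    refine ⟨fun hord => hn.not_gt (hk m (le_of_lt hm) _ (hord m)), ?_, hm⟩
    obtain ⟨v, hv, hmv, -⟩ := hx.ord (n, m)
    have hvM : v ≤ M := not_lt.1 fun hlt => (hn.trans hv).not_gt
      ((pow_le_pow_of_le_one hϖ.norm_pos.le hϖ.norm_lt_one.le hlt.le).trans_lt hM)
    have : ((s : ℕ) : ℤ) * v ≤ (s : ℕ) * M := by gcongr
    simp only at hmv ⊢
    linarith

theorem Overconvergent.indicator (hx : Overconvergent ϖ s x) (T : Set (L × ℤ)) :
    Overconvergent ϖ s (T.indicator x) where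
  ord g := (hx.ord g).of_norm_le (norm_indicator_le_norm_self x g)
  eventually k := (hx.eventually k).mono fun _ hn m =>
    (hn m).of_norm_le (norm_indicator_le_norm_self x _)

theorem Overconvergent.single [DecidableEq (L × ℤ)] {u : L × ℤ} {c : E} (h : Ord ϖ s 0 u.2 c) :
    Overconvergent ϖ s (Pi.single u c : L × ℤ → E) where
  ord g := by
    obtain rfl | hg := eq_or_ne g u
    · simpa using h
    · rw [Pi.single_eq_of_ne hg]
      exact Ord.zero _ _ _
  eventually k := by
    filter_upwards [(Set.finite_singleton u.1).compl_mem_cofinite] with n hn m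
    rw [Pi.single_eq_of_ne fun h : (n, m) = u => hn (congrArg Prod.fst h)]
    exact Ord.zero _ _ _

theorem Overconvergent.tsum [IsUltrametricDist E] (hϖ : IsUniformizer ϖ) {x : ℕ → L × ℤ → E}
    (hx : ∀ i, Overconvergent ϖ s (x i)) (h : ∀ i g, Ord ϖ s i g.2 (x i g)) :
    Overconvergent ϖ s fun g => ∑' i, x i g where
  ord g := Ord.tsum hϖ fun i => (hx i).ord g
  eventually k := by
    filter_upwards [(Set.finite_Iio k).eventually_all.2 fun i _ => (hx i).eventually k] with n hn m
    refine Ord.tsum hϖ fun i => ?_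
    obtain hi | hi := lt_or_ge i k
    · exact hn i hi m
    · exact (h i (n, m)).mono hi

theorem overconvergent_of_norm_lt [AddCommGroup L] (hϖ : IsUniformizer ϖ)
    (hx : Good (degY L) x) (h : ∀ g, x g ≠ 0 → ‖ϖ‖ < ‖x g‖ ∧ 0 ≤ g.2) : Overconvergent ϖ s x where
  ord g := by
    obtain h0 | h0 := eq_or_ne (x g) 0
    · rw [h0]
      exact Ord.zero _ _ _
    · exact Ord.of_le (hx.le_one g) (h g h0).2
  eventually k := by
    have hfin : {g | degY L g < k ∧ ‖ϖ‖ ≤ ‖x g‖}.Finite := hx.finite _ hϖ.norm_pos k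
    filter_upwards [(hfin.image Prod.fst).compl_mem_cofinite] with n hn m
    obtain h0 | h0 := eq_or_ne (x (n, m)) 0
    · rw [h0]
      exact Ord.zero _ _ _
    · refine Ord.of_le (hx.le_one _) (not_lt.1 fun hmk => hn ?_)
      exact ⟨(n, m), ⟨hmk, (h _ h0).1.le⟩, rfl⟩

end Coefficients

section Multivariable

variable {p : ℕ} {E : Type*} [NormedField E] {f : ℕ}

/-- The monomial `c U^{u.1} Y_{σ₀}^{u.2}` of `A_{mv,E}`. -/
noncomputable def Amv.monomial (u : (Fin (f - 1) → ℤ) × ℤ) (c : E) (hc : ‖c‖ ≤ 1) : Amv p E f :=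
  .mk' (Pi.single u c) (Good.single u hc)

@[simp] theorem Amv.fn_monomial (u : (Fin (f - 1) → ℤ) × ℤ) (c : E) (hc : ‖c‖ ≤ 1) :
    (monomial u c hc : Amv p E f).fn = Pi.single u c := rfl

variable [Fact p.Prime] [NormedAlgebra ℚ_[p] E]

@[simp] theorem Amv.fn_monomial_mul (u : (Fin (f - 1) → ℤ) × ℤ) (c : E) (hc : ‖c‖ ≤ 1)
    (a : Amv p E f) (g : (Fin (f - 1) → ℤ) × ℤ) :
    (monomial u c hc * a).fn g = c * a.fn (g - u) :=
  single_conv u c a.fn g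

variable {ϖ : E} (hϖ : IsUniformizer ϖ)

variable (p f) in
/-- The uniformizer `ϖ` as an element of `A_{mv,E}`. -/
noncomputable def Amv.uniformizer : Amv p E f := monomial 0 ϖ hϖ.norm_lt_one.le

@[simp] theorem Amv.fn_uniformizer_mul (a : Amv p E f) (g : (Fin (f - 1) → ℤ) × ℤ) :
    (uniformizer p f hϖ * a).fn g = ϖ * a.fn g := by
  simp [uniformizer]

variable [FiniteDimensional ℚ_[p] E]

theorem Amv.fn_sum {ι : Type*} (S : Finset ι) (a : ι → Amv p E f) :
    (∑ i ∈ S, a i).fn = ∑ i ∈ S, (a i).fn :=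
  map_sum (AddMonoidHom.mk' (fn : Amv p E f → _) fn_add) a S

@[simp] theorem Amv.fn_Y₀_inv_mul (a : Amv p E f) (g : (Fin (f - 1) → ℤ) × ℤ) :
    (↑(Y₀ p E f)⁻¹ * a).fn g = a.fn (g + (0, 1)) := by
  refine (fn_monomial_mul (0, -1) 1 norm_one.le a g).trans ?_
  rw [one_mul, sub_eq_add_neg]
  simp

@[simp] theorem Amv.fn_Y₀_pow_mul (k : ℕ) (a : Amv p E f) (g : (Fin (f - 1) → ℤ) × ℤ) :
    ((Y₀ p E f : Amv p E f) ^ k * a).fn g = a.fn (g - (0, (k : ℤ))) := by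
  induction k generalizing g with
  | zero => simp [← Prod.zero_eq_mk]
  | succ k ih =>
    rw [pow_succ', mul_assoc]
    refine (fn_monomial_mul (0, 1) 1 norm_one.le _ g).trans ?_
    rw [one_mul, ih, sub_sub]
    simp [add_comm]

theorem Amv.tsum_monomial_pow_mul {u : (Fin (f - 1) → ℤ) × ℤ} {e : E} (he : ‖e‖ ≤ 1)
    (c : ℕ → Amv p E f) {g : (Fin (f - 1) → ℤ) × ℤ}
    (hc : Summable fun i => (monomial u e he ^ i * c i).fn g) :
    ∑' i, (monomial u e he ^ i * c i).fn g =
      (c 0).fn g + e * ∑' i, (monomial u e he ^ i * c (i + 1)).fn (g - u) := by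
  have := isUltrametricDist p E
  rw [hc.tsum_eq_zero_add, ← tsum_mul_left]
  simp only [pow_zero, one_mul, pow_succ', mul_assoc, fn_monomial_mul]

theorem Amv.norm_fn_uniformizer_pow_mul_le (a : Amv p E f) (n : ℕ)
    (g : (Fin (f - 1) → ℤ) × ℤ) : ‖(uniformizer p f hϖ ^ n * a).fn g‖ ≤ ‖ϖ‖ ^ n := by
  induction n with
  | zero => simpa using a.good.le_one g
  | succ n ih =>
    rw [pow_succ', mul_assoc, fn_uniformizer_mul, norm_mul, pow_succ']
    gcongr

theorem Amv.uniformizer_dvd_iff {a : Amv p E f} :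
    uniformizer p f hϖ ∣ a ↔ ∀ g, ‖a.fn g‖ ≤ ‖ϖ‖ := by
  refine ⟨?_, fun h => ?_⟩
  · rintro ⟨b, rfl⟩ g
    simpa using norm_fn_uniformizer_pow_mul_le hϖ b 1 g
  have good_div : Good (degY _) fun g => a.fn g / ϖ := by
    refine ⟨fun g => ?_, fun ε hε N => ?_⟩
    · rw [norm_div]
      exact div_le_one_of_le₀ (h g) (norm_nonneg _)
    · refine (a.good.finite _ (mul_pos hε hϖ.norm_pos) N).subset fun g hg => ⟨hg.1, ?_⟩
      rw [← le_div_iff₀ hϖ.norm_pos, ← norm_div]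
      exact hg.2
  refine ⟨.mk' _ good_div, fn_injective (funext fun g => ?_)⟩
  rw [fn_uniformizer_mul, fn_mk', mul_div_cancel₀ _ hϖ.1]

theorem Amv.isHausdorff_uniformizer :
    IsHausdorff (Ideal.span {uniformizer p f hϖ}) (Amv p E f) := by
  refine isHausdorff_span_singleton fun a ha => fn_injective (funext fun g => ?_)
  by_contra hg
  obtain ⟨n, hn⟩ := exists_pow_lt_of_lt_one (norm_pos_iff.2 hg) hϖ.norm_lt_one
  obtain ⟨b, rfl⟩ := ha n
  exact hn.not_ge (norm_fn_uniformizer_pow_mul_le hϖ b n g)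

theorem Amv.isPrecomplete_uniformizer :
    IsPrecomplete (Ideal.span {uniformizer p f hϖ}) (Amv p E f) := by
  have := isUltrametricDist p E
  have := completeSpace p E
  have tail_lt (c : ℕ → Amv p E f) (ε : ℝ) (hε : 0 < ε) :
      ∃ k, ∀ i ≥ k, ∀ g, ‖(uniformizer p f hϖ ^ i * c i).fn g‖ < ε := by
    obtain ⟨k, hk⟩ := exists_pow_lt_of_lt_one hε hϖ.norm_lt_one
    exact ⟨k, fun i hi g => ((norm_fn_uniformizer_pow_mul_le hϖ (c i) i g).trans
      (pow_le_pow_of_le_one hϖ.norm_pos.le hϖ.norm_lt_one.le hi)).trans_lt hk⟩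
  refine isPrecomplete_span_singleton
    (fun c => .mk' _ (Good.tsum (fun i => (uniformizer p f hϖ ^ i * c i).good) (tail_lt c)))
    fun c => fn_injective (funext fun g => ?_)
  have hsum : Summable fun i => (uniformizer p f hϖ ^ i * c i).fn g :=
    summable_of_finite fun ε hε => by
      obtain ⟨k, hk⟩ := tail_lt c ε hε
      exact (Set.finite_Iio k).subset fun i hi => not_le.1 fun hki => (hk i hki g).not_ge hi
  refine (tsum_monomial_pow_mul hϖ.norm_lt_one.le c hsum).trans ?_
  rw [smul_eq_mul, fn_add, Pi.add_apply, fn_uniformizer_mul, fn_mk', sub_zero]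
  rfl

theorem Amv.isAdicComplete_uniformizer :
    IsAdicComplete (Ideal.span {uniformizer p f hϖ}) (Amv p E f) where
  toIsHausdorff := isHausdorff_uniformizer hϖ
  toIsPrecomplete := isPrecomplete_uniformizer hϖ

end Multivariable

section DaggerS

variable {p : ℕ} [Fact p.Prime] {E : Type*} [NormedField E] [NormedAlgebra ℚ_[p] E]
  [FiniteDimensional ℚ_[p] E] {ϖ : E} (hϖ : IsUniformizer ϖ) {f : ℕ} {s : ℕ+}

theorem mem_AmvDaggerS_iff {a : Amv p E f} : a ∈ AmvDaggerS p hϖ f s ↔ Overconvergent ϖ s a.fn :=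
  (mem_AmvDaggerSet_iff p hϖ).trans ⟨fun h => ⟨fun g => h.1 g.1 g.2, h.2⟩,
    fun h => ⟨fun n m => h.1 (n, m), h.2⟩⟩

theorem AmvDaggerS.overconvergent (a : AmvDaggerS p hϖ f s) : Overconvergent ϖ s a.1.fn :=
  (mem_AmvDaggerS_iff hϖ).1 a.2

variable {hϖ} in
theorem AmvDaggerS.ext {a b : AmvDaggerS p hϖ f s} (h : ∀ g, a.1.fn g = b.1.fn g) : a = b :=
  Subtype.ext (Amv.fn_injective (funext h))

variable (p) in
/-- The element of `A_{mv,E}^{†,s}` with given coefficients. -/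
def Overconvergent.toAmvDaggerS {x : (Fin (f - 1) → ℤ) × ℤ → E} (hx : Overconvergent ϖ s x) :
    AmvDaggerS p hϖ f s :=
  ⟨.mk' x (hx.good hϖ), (mem_AmvDaggerS_iff hϖ).2 hx⟩

@[simp] theorem Overconvergent.fn_toAmvDaggerS {x : (Fin (f - 1) → ℤ) × ℤ → E}
    (hx : Overconvergent ϖ s x) : (hx.toAmvDaggerS p hϖ).1.fn = x := rfl

variable (p) in
/-- The monomial `c U^{u.1} Y_{σ₀}^{u.2}` of `A_{mv,E}^{†,s}`. -/
noncomputable def AmvDaggerS.monomial (u : (Fin (f - 1) → ℤ) × ℤ) (c : E) (h : Ord ϖ s 0 u.2 c) :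
    AmvDaggerS p hϖ f s :=
  ⟨.monomial u c (h.norm_le_one hϖ), (mem_AmvDaggerS_iff hϖ).2 (.single h)⟩

section Monomial

variable {u : (Fin (f - 1) → ℤ) × ℤ} {e : E}

@[simp] theorem AmvDaggerS.fn_monomial (h : Ord ϖ s 0 u.2 e) :
    (monomial p hϖ u e h).1.fn = Pi.single u e := rfl

@[simp] theorem AmvDaggerS.fn_monomial_mul (h : Ord ϖ s 0 u.2 e) (a : AmvDaggerS p hϖ f s)
    (g : (Fin (f - 1) → ℤ) × ℤ) : (monomial p hϖ u e h * a).1.fn g = e * a.1.fn (g - u) :=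
  Amv.fn_monomial_mul u e (h.norm_le_one hϖ) a.1 g

theorem AmvDaggerS.monomial_mul_monomial (h : Ord ϖ s 0 u.2 e) {v : (Fin (f - 1) → ℤ) × ℤ} {d : E}
    (h' : Ord ϖ s 0 v.2 d) :
    monomial p hϖ u e h * monomial p hϖ v d h' = monomial p hϖ (u + v) (e * d) (h.mul h') :=
  ext fun g => by
    rw [fn_monomial_mul, fn_monomial, fn_monomial]
    simp [Pi.single_apply, sub_eq_iff_eq_add']

theorem AmvDaggerS.ord_monomial_pow_mul (he : Ord ϖ s 1 u.2 e) (a : AmvDaggerS p hϖ f s) (n : ℕ)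
    (g : (Fin (f - 1) → ℤ) × ℤ) :
    Ord ϖ s n g.2 ((monomial p hϖ u e (he.mono zero_le_one) ^ n * a).1.fn g) := by
  induction n generalizing g with
  | zero => simpa using (overconvergent hϖ a).ord g
  | succ n ih =>
    rw [pow_succ', mul_assoc, fn_monomial_mul, add_comm n 1]
    simpa using he.mul (ih (g - u))

theorem AmvDaggerS.isHausdorff_monomial (he : Ord ϖ s 1 u.2 e) :
    IsHausdorff (Ideal.span {monomial p hϖ u e (he.mono zero_le_one)})
      (AmvDaggerS p hϖ f s) := by
  refine isHausdorff_span_singleton fun a ha => AmvDaggerS.ext fun g => ?_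
  refine Ord.eq_zero hϖ (s := s) (m := g.2) fun n => ?_
  obtain ⟨b, rfl⟩ := ha n
  exact ord_monomial_pow_mul hϖ he b n g

theorem AmvDaggerS.isPrecomplete_monomial (he : Ord ϖ s 1 u.2 e) :
    IsPrecomplete (Ideal.span {monomial p hϖ u e (he.mono zero_le_one)})
      (AmvDaggerS p hϖ f s) := by
  have := isUltrametricDist p E
  have := completeSpace p E
  set z := monomial p hϖ u e (he.mono zero_le_one)
  refine isPrecomplete_span_singleton (fun c => (Overconvergent.tsum hϖ
    (fun i => overconvergent hϖ (z ^ i * c i))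
    fun i => ord_monomial_pow_mul hϖ he (c i) i).toAmvDaggerS p hϖ)
    fun c => AmvDaggerS.ext fun g => ?_
  have hsum : Summable fun i => (z ^ i * c i).1.fn g := summable_of_finite fun ε hε => by
    obtain ⟨k, hk⟩ := Ord.exists_norm_lt hϖ s g.2 hε
    exact (Set.finite_Iio k).subset fun i hi => not_le.1 fun hki =>
      (hk _ le_rfl _ ((ord_monomial_pow_mul hϖ he (c i) i g).mono hki)).not_ge hi
  refine (Amv.tsum_monomial_pow_mul (he.norm_le_one hϖ) (fun i => (c i).1) hsum).trans ?_
  rw [smul_eq_mul, Subring.coe_add, Amv.fn_add, Pi.add_apply, fn_monomial_mul,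
    Overconvergent.fn_toAmvDaggerS]
  rfl

end Monomial

variable (p f s)

/-- The element `ϖ / Y_{σ₀}^s` of `A_{mv,E}^{†,s}`. -/
noncomputable def AmvDaggerS.X : AmvDaggerS p hϖ f s :=
  monomial p hϖ (0, -(s : ℤ)) ϖ ((ord_X s).mono zero_le_one)

/-- The element `Y_{σ₀}` of `A_{mv,E}^{†,s}`. -/
noncomputable def AmvDaggerS.Y : AmvDaggerS p hϖ f s :=
  monomial p hϖ (0, 1) 1 ((ord_Y s).mono zero_le_one)

theorem AmvDaggerS.coe_Y : (Y p hϖ f s : Amv p E f) = Amv.Y₀ p E f := rfl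

theorem Y₀_mem_AmvDaggerS : (Amv.Y₀ p E f : Amv p E f) ∈ AmvDaggerS p hϖ f s :=
  (AmvDaggerS.Y p hϖ f s).2

theorem AmvDaggerS.X_mul_Y_pow :
    (X p hϖ f s * Y p hϖ f s ^ (s : ℕ)).1 = Amv.uniformizer p f hϖ := by
  refine Amv.fn_injective (funext fun g => ?_)
  rw [mul_comm, Subring.coe_mul, Subring.coe_pow, coe_Y, Amv.fn_Y₀_pow_mul, X, fn_monomial,
    Amv.uniformizer, Amv.fn_monomial]
  simp [Pi.single_apply, sub_eq_iff_eq_add, Prod.mk_zero_zero]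

instance AmvDaggerS.isAdicComplete_X :
    IsAdicComplete (Ideal.span {X p hϖ f s}) (AmvDaggerS p hϖ f s) where
  toIsHausdorff := isHausdorff_monomial hϖ (ord_X s)
  toIsPrecomplete := isPrecomplete_monomial hϖ (ord_X s)

instance AmvDaggerS.isPrecomplete_Y :
    IsPrecomplete (Ideal.span {Y p hϖ f s}) (AmvDaggerS p hϖ f s) :=
  isPrecomplete_monomial hϖ (ord_Y s)

variable {p f s}

theorem Y₀_pow_mul_mem_of_uniformizer_mul_mem {a : Amv p E f}
    (h : Amv.uniformizer p f hϖ * a ∈ AmvDaggerS p hϖ f s) :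
    (Amv.Y₀ p E f : Amv p E f) ^ (s : ℕ) * a ∈ AmvDaggerS p hϖ f s := by
  have ord_shift (k : ℕ) (g : (Fin (f - 1) → ℤ) × ℤ)
      (hord : Ord ϖ s k (g - (0, (s : ℤ))).2 (ϖ * a.fn (g - (0, (s : ℤ))))) :
      Ord ϖ s (k - 1) g.2 (a.fn (g - (0, (s : ℤ)))) := by
    simpa using hord.of_uniformizer_mul hϖ (a.good.le_one _)
  rw [mem_AmvDaggerS_iff] at h ⊢
  have hord (g) : Ord ϖ s 0 g.2 (ϖ * a.fn g) := by simpa using h.ord g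
  refine ⟨fun g => ?_, fun k => ?_⟩
  · rw [Amv.fn_Y₀_pow_mul]
    exact ord_shift 0 g (hord _)
  · filter_upwards [h.eventually (k + 1)] with n hn m
    rw [Amv.fn_Y₀_pow_mul]
    refine ord_shift (k + 1) (n, m) ?_
    simpa using hn (m - s)

theorem AmvDaggerS.X_dvd_iff {a : AmvDaggerS p hϖ f s} :
    X p hϖ f s ∣ a ↔ ∀ g, ‖a.1.fn g‖ ≤ ‖ϖ‖ := by
  refine ⟨?_, fun h => ?_⟩
  · rintro ⟨b, rfl⟩ g
    rw [X, fn_monomial_mul, norm_mul]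
    exact mul_le_of_le_one_right (norm_nonneg _) (b.1.good.le_one _)
  · obtain ⟨b, hb⟩ := (Amv.uniformizer_dvd_iff hϖ).2 h
    have mem : Amv.uniformizer p f hϖ * b ∈ AmvDaggerS p hϖ f s := hb ▸ a.2
    refine ⟨⟨_, Y₀_pow_mul_mem_of_uniformizer_mul_mem hϖ mem⟩, Subtype.ext (hb.trans ?_)⟩
    rw [← X_mul_Y_pow p hϖ f s, Subring.coe_mul, Subring.coe_mul, Subring.coe_pow, coe_Y, mul_assoc]

theorem AmvDaggerS.Y_dvd {a : AmvDaggerS p hϖ f s}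
    (h : ∀ g, a.1.fn g ≠ 0 → ‖ϖ‖ < ‖a.1.fn g‖ ∧ 1 ≤ g.2) : Y p hϖ f s ∣ a := by
  refine ⟨⟨↑(Amv.Y₀ p E f)⁻¹ * a.1, (mem_AmvDaggerS_iff hϖ).2 (overconvergent_of_norm_lt hϖ
    (Amv.good _) fun g hg => ?_)⟩, Subtype.ext ?_⟩
  · rw [Amv.fn_Y₀_inv_mul] at hg ⊢
    simpa using h _ hg
  · rw [Subring.coe_mul, coe_Y, Units.mul_inv_cancel_left]

instance AmvDaggerS.isHausdorff_Y :
    IsHausdorff (Ideal.span {Y p hϖ f s}) (AmvDaggerS p hϖ f s ⧸ Ideal.span {X p hϖ f s}) := by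
  have := isUltrametricDist p E
  refine isHausdorff_span_singleton fun a ha => ?_
  obtain ⟨a, rfl⟩ := Ideal.Quotient.mk_surjective a
  rw [Ideal.Quotient.eq_zero_iff_mem, Ideal.mem_span_singleton, X_dvd_iff]
  intro g
  obtain ⟨b, hb⟩ := ha (g.2.toNat + 1)
  obtain ⟨b, rfl⟩ := Ideal.Quotient.mk_surjective b
  have norm_sub_le : ‖(a - Y p hϖ f s ^ (g.2.toNat + 1) * b).1.fn g‖ ≤ ‖ϖ‖ :=
    (X_dvd_iff hϖ).1 (Ideal.mem_span_singleton.1 (Ideal.Quotient.eq.1 hb.symm)) g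
  have norm_le : ‖(Y p hϖ f s ^ (g.2.toNat + 1) * b).1.fn g‖ ≤ ‖ϖ‖ := not_lt.1 fun hlt => by
    have := (ord_monomial_pow_mul hϖ (ord_Y s) b _ g).le_of_norm_lt hϖ hlt
    omega
  rw [← sub_add_cancel a (Y p hϖ f s ^ (g.2.toNat + 1) * b), Subring.coe_add, Amv.fn_add,
    Pi.add_apply]
  exact (IsUltrametricDist.norm_add_le_max _ _).trans (max_le norm_sub_le norm_le)

end DaggerS

section Noetherian

variable {p : ℕ} [Fact p.Prime] {E : Type*} [NormedField E] [NormedAlgebra ℚ_[p] E]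
  [FiniteDimensional ℚ_[p] E] {ϖ : E} (hϖ : IsUniformizer ϖ) {f : ℕ} {s : ℕ+}

section Laurent

variable [IsUltrametricDist E]

/-- The constants `c ∈ 𝒪_E` of `A_{mv,E}^{†,s}`. -/
noncomputable def AmvDaggerS.C :
    (NormedField.valuation (K := E)).integer →+* AmvDaggerS p hϖ f s where
  toFun c := monomial p hϖ 0 c.1 (.of_le c.2 le_rfl)
  map_one' := rfl
  map_zero' := ext fun g => by simp
  map_add' c d := ext fun g => by simp [Pi.single_add]
  map_mul' c d := by
    rw [monomial_mul_monomial]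
    simp

/-- The monomials `U^n` of `A_{mv,E}^{†,s}`. -/
noncomputable def AmvDaggerS.U :
    Multiplicative (Fin (f - 1) → ℤ) →* AmvDaggerS p hϖ f s where
  toFun n := monomial p hϖ (n.toAdd, 0) 1 (.of_le norm_one.le le_rfl)
  map_one' := rfl
  map_mul' n m := by
    rw [monomial_mul_monomial]
    simp

variable (p f s) in
/-- The Laurent polynomials in the `U_i` over `𝒪_E`, mapped to `A_{mv,E}^{†,s}`. -/
noncomputable def AmvDaggerS.laurent :
    AddMonoidAlgebra (NormedField.valuation (K := E)).integer (Fin (f - 1) → ℤ) →+*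
      AmvDaggerS p hϖ f s :=
  AddMonoidAlgebra.liftNCRingHom (C hϖ) (U hϖ) fun _ _ => Commute.all _ _

theorem AmvDaggerS.laurent_single (n : Fin (f - 1) → ℤ)
    (c : (NormedField.valuation (K := E)).integer) :
    laurent p hϖ f s (AddMonoidAlgebra.single n c) =
      monomial p hϖ (n, 0) c.1 (.of_le c.2 le_rfl) := by
  refine (AddMonoidAlgebra.liftNC_single _ _ _ _).trans
    ((monomial_mul_monomial hϖ (.of_le c.2 le_rfl) (.of_le norm_one.le le_rfl)).trans ?_)
  simp

theorem AmvDaggerS.mem_range_laurent {a : AmvDaggerS p hϖ f s}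
    (hfin : {g | a.1.fn g ≠ 0}.Finite) (h : ∀ g, a.1.fn g ≠ 0 → g.2 = 0) :
    a ∈ (laurent p hϖ f s).range := by
  classical
  refine ⟨∑ g ∈ hfin.toFinset, AddMonoidAlgebra.single g.1 ⟨a.1.fn g, a.1.good.le_one g⟩,
    ext fun g => ?_⟩
  simp only [map_sum, laurent_single, AddSubmonoidClass.coe_finsetSum, Amv.fn_sum, Finset.sum_apply,
    fn_monomial]
  calc ∑ g' ∈ hfin.toFinset, (Pi.single (g'.1, 0) (a.1.fn g') : _ → E) g
      = ∑ g' ∈ hfin.toFinset, (Pi.single g' (a.1.fn g') : _ → E) g :=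
        Finset.sum_congr rfl fun g' hg' => by rw [← h g' (hfin.mem_toFinset.1 hg')]
    _ = a.1.fn g := by
        rw [Finset.sum_pi_single]
        simp +contextual

theorem AmvDaggerS.exists_eq_laurent_add (a : AmvDaggerS p hϖ f s) :
    ∃ d b c, a = laurent p hϖ f s d + X p hϖ f s * b + Y p hϖ f s * c := by
  have ha := overconvergent hϖ a
  have hdeg (g) (hg : ‖ϖ‖ < ‖a.1.fn g‖) : 0 ≤ g.2 := (ha.ord g).le_of_norm_lt hϖ hg
  let big : Set ((Fin (f - 1) → ℤ) × ℤ) := {g | ‖ϖ‖ < ‖a.1.fn g‖}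
  let deg₀ : Set ((Fin (f - 1) → ℤ) × ℤ) := {g | g.2 = 0}
  let part (T : Set ((Fin (f - 1) → ℤ) × ℤ)) : AmvDaggerS p hϖ f s :=
    (ha.indicator T).toAmvDaggerS p hϖ
  have part_ne {T g} (hg : (part T).1.fn g ≠ 0) : g ∈ T := Set.mem_of_indicator_ne_zero hg
  have part_zero {T g} (hg : g ∉ T) : (part T).1.fn g = 0 := Set.indicator_of_notMem hg _
  have part_eq {T g} (hg : g ∈ T) : (part T).1.fn g = a.1.fn g := Set.indicator_of_mem hg _
  obtain ⟨b, hb⟩ : X p hϖ f s ∣ part bigᶜ := (X_dvd_iff hϖ).2 fun g => by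
    by_cases hg : g ∈ bigᶜ
    · rw [part_eq hg]
      exact not_lt.1 hg
    · rw [part_zero hg, norm_zero]
      exact norm_nonneg ϖ
  obtain ⟨c, hc⟩ : Y p hϖ f s ∣ part (big \ deg₀) := Y_dvd hϖ fun g hg => by
    have mem := part_ne hg
    rw [part_eq mem]
    exact ⟨mem.1, lt_of_le_of_ne' (hdeg g mem.1) mem.2⟩
  obtain ⟨d, hd⟩ : part (big ∩ deg₀) ∈ (laurent p hϖ f s).range := by
    refine mem_range_laurent hϖ ?_ fun g hg => (part_ne hg).2
    have hfin : {n | ¬ ∀ m, Ord ϖ s 1 m (a.1.fn (n, m))}.Finite := ha.eventually 1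
    refine (hfin.prod (Set.finite_singleton 0)).subset fun g hg => ?_
    obtain ⟨hgbig, hg0⟩ := part_ne hg
    refine ⟨fun hord => ?_, hg0⟩
    have : ((1 : ℕ) : ℤ) ≤ g.2 := (hord g.2).le_of_norm_lt hϖ hgbig
    exact absurd this (by rw [hg0]; decide)
  refine ⟨d, b, c, ?_⟩
  rw [hd, ← hb, ← hc]
  refine ext fun g => ?_
  by_cases hg : g ∈ big <;> by_cases hg0 : g ∈ deg₀ <;> simp [part, hg, hg0]

end Laurent

instance isNoetherianRing_AmvDaggerS : IsNoetherianRing (AmvDaggerS p hϖ f s) := by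
  have := isUltrametricDist p E
  have : ProperSpace E := FiniteDimensional.proper ℚ_[p] E
  let O := (NormedField.valuation (K := E)).integer
  have : IsNoetherianRing O := isNoetherianRing_integer E
  have : IsNoetherianRing (AddMonoidAlgebra O (Fin (f - 1) → ℤ)) :=
    Algebra.FiniteType.isNoetherianRing O _
  let I := Ideal.span {AmvDaggerS.X p hϖ f s} ⊔ Ideal.span {AmvDaggerS.Y p hϖ f s}
  have : IsNoetherianRing (AmvDaggerS p hϖ f s ⧸ I) := by
    refine isNoetherianRing_of_surjective _ _
      ((Ideal.Quotient.mk I).comp (AmvDaggerS.laurent p hϖ f s)) fun a => ?_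
    obtain ⟨a, rfl⟩ := Ideal.Quotient.mk_surjective a
    obtain ⟨d, b, c, h⟩ := AmvDaggerS.exists_eq_laurent_add hϖ a
    refine ⟨d, Eq.symm (Ideal.Quotient.eq.2 ?_)⟩
    rw [h, add_assoc, add_sub_cancel_left]
    exact Submodule.add_mem_sup (Ideal.mem_span_singleton.2 (dvd_mul_right _ _))
      (Ideal.mem_span_singleton.2 (dvd_mul_right _ _))
  exact isNoetherianRing_of_isAdicComplete_pair (AmvDaggerS.X p hϖ f s) (AmvDaggerS.Y p hϖ f s)

end Noetherian

section Flatness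

variable (p : ℕ) [Fact p.Prime] {E : Type*} [NormedField E] [NormedAlgebra ℚ_[p] E]
  [FiniteDimensional ℚ_[p] E] {ϖ : E} (hϖ : IsUniformizer ϖ) (f : ℕ) (s : ℕ+)

/-- The ring `A_{mv,E}^{†,s}[1 / Y_{σ₀}]`, as a subring of `A_{mv,E}`. -/
noncomputable abbrev AmvDaggerSInv : Subring (Amv p E f) :=
  adjoinInv (AmvDaggerS p hϖ f s) (Amv.Y₀ p E f) (Y₀_mem_AmvDaggerS p hϖ f s)

variable {p f s}

theorem exists_mem_AmvDaggerSInv_add (a : Amv p E f) :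
    ∃ b ∈ AmvDaggerSInv p hϖ f s, ∃ c, a = b + Amv.uniformizer p f hϖ * c := by
  let big : Set ((Fin (f - 1) → ℤ) × ℤ) := {g | ‖ϖ‖ < ‖a.fn g‖}
  obtain ⟨c, hc⟩ : Amv.uniformizer p f hϖ ∣ .mk' _ (a.good.indicator bigᶜ) := by
    refine (Amv.uniformizer_dvd_iff hϖ).2 fun g => ?_
    rw [Amv.fn_mk']
    by_cases hg : g ∈ big
    · simp [hg]
    · rw [Set.indicator_of_mem hg]
      exact not_lt.1 hg
  refine ⟨.mk' _ (a.good.indicator big), ?_, c, ?_⟩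
  · obtain ⟨B, hB⟩ := Good.bddBelow a.good hϖ.norm_pos
    refine ⟨(-B).toNat, (mem_AmvDaggerS_iff hϖ).2 (overconvergent_of_norm_lt hϖ (Amv.good _)
      fun g hg => ?_)⟩
    rw [Amv.fn_Y₀_pow_mul, Amv.fn_mk'] at hg ⊢
    have mem := Set.mem_of_indicator_ne_zero hg
    have hdeg : B ≤ g.2 - ((-B).toNat : ℤ) := hB _ (le_of_lt mem)
    rw [Set.indicator_of_mem mem]
    exact ⟨mem, by omega⟩
  · rw [← hc]
    exact Amv.fn_injective (Set.indicator_self_add_compl big a.fn).symm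

theorem mem_AmvDaggerSInv_of_uniformizer_mul_mem {a : Amv p E f}
    (h : Amv.uniformizer p f hϖ * a ∈ AmvDaggerSInv p hϖ f s) : a ∈ AmvDaggerSInv p hϖ f s := by
  obtain ⟨k, hk⟩ := h
  rw [mul_left_comm] at hk
  refine ⟨s + k, ?_⟩
  rw [pow_add, mul_assoc]
  exact Y₀_pow_mul_mem_of_uniformizer_mul_mem hϖ hk

theorem uniformizer_mem_AmvDaggerS : Amv.uniformizer p f hϖ ∈ AmvDaggerS p hϖ f s :=
  AmvDaggerS.X_mul_Y_pow p hϖ f s ▸ (AmvDaggerS.X p hϖ f s * AmvDaggerS.Y p hϖ f s ^ (s : ℕ)).2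

theorem flat_AmvDaggerSInv : Module.Flat (AmvDaggerSInv p hϖ f s) (Amv p E f) := by
  let x : AmvDaggerSInv p hϖ f s :=
    ⟨Amv.uniformizer p f hϖ, le_adjoinInv _ (uniformizer_mem_AmvDaggerS hϖ)⟩
  have := isNoetherianRing_adjoinInv (Y₀_mem_AmvDaggerS p hϖ f s)
  have : IsAdicComplete (Ideal.span {x}) (Amv p E f) := by
    rw [← IsAdicComplete.map_algebraMap_iff (S := Amv p E f), Ideal.map_span, Set.image_singleton]
    exact Amv.isAdicComplete_uniformizer hϖ
  refine flat_of_isAdicComplete_span_singleton (x := x)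
    (f := Algebra.linearMap (AmvDaggerSInv p hϖ f s) (Amv p E f)) Subtype.val_injective ?_ ?_
  · rintro a ⟨b, hb : b.1 = Amv.uniformizer p f hϖ * a⟩
    have mem : Amv.uniformizer p f hϖ * a ∈ AmvDaggerSInv p hϖ f s := hb ▸ b.2
    exact ⟨⟨a, mem_AmvDaggerSInv_of_uniformizer_mul_mem hϖ mem⟩, rfl⟩
  · intro a
    obtain ⟨b, hb, c, h⟩ := exists_mem_AmvDaggerSInv_add hϖ (s := s) a
    exact ⟨⟨b, hb⟩, c, h⟩

theorem AmvDaggerInf_eq_iSup : AmvDaggerInf p hϖ f = ⨆ s, AmvDaggerS p hϖ f s := by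
  ext a
  rw [Subring.mem_iSup_of_directed (Monotone.directed_le fun _ _ h => AmvDaggerS_mono p hϖ f h)]
  exact Set.mem_iUnion

theorem AmvDagger_eq_adjoinInv :
    AmvDagger p hϖ f = adjoinInv (AmvDaggerInf p hϖ f) (Amv.Y₀ p E f) (Amv.Y₀_mem p hϖ f) := by
  ext a
  constructor
  · rintro ⟨k, y, hy, rfl⟩
    refine ⟨k, ?_⟩
    rwa [mul_left_comm, ← mul_pow, Units.mul_inv, one_pow, mul_one]
  · rintro ⟨k, hk⟩
    refine ⟨k, _, hk, ?_⟩
    rw [mul_right_comm, ← mul_pow, Units.mul_inv, one_pow, one_mul]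

theorem mem_AmvDagger_iff {a : Amv p E f} :
    a ∈ AmvDagger p hϖ f ↔ ∃ s, a ∈ AmvDaggerSInv p hϖ f s := by
  rw [AmvDagger_eq_adjoinInv]
  exact (exists_congr fun _ => Set.mem_iUnion).trans exists_comm

variable (p f)

theorem flat_AmvDaggerInf : Module.Flat (AmvDaggerInf p hϖ f) (Amv p E f) := by
  rw [AmvDaggerInf_eq_iSup]
  exact flat_iSup_of_directed (Monotone.directed_le fun _ _ h => AmvDaggerS_mono p hϖ f h)
    fun s => (flat_adjoinInv_iff (Y₀_mem_AmvDaggerS p hϖ f s)).1 (flat_AmvDaggerSInv hϖ)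

theorem flat_AmvDagger : Module.Flat (AmvDagger p hϖ f) (Amv p E f) := by
  rw [AmvDagger_eq_adjoinInv]
  exact (flat_adjoinInv_iff (Amv.Y₀_mem p hϖ f)).2 (flat_AmvDaggerInf p hϖ f)

theorem uniformizer_mem_AmvDagger : Amv.uniformizer p f hϖ ∈ AmvDagger p hϖ f :=
  (mem_AmvDagger_iff hϖ).2 ⟨1, le_adjoinInv _ (uniformizer_mem_AmvDaggerS hϖ)⟩

theorem uniformizer_mem_jacobson_AmvDagger :
    (⟨_, uniformizer_mem_AmvDagger p hϖ f⟩ : AmvDagger p hϖ f) ∈ Ideal.jacobson ⊥ := by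
  refine Ideal.mem_jacobson_bot.2 fun y => ?_
  obtain ⟨s, k, hk⟩ := (mem_AmvDagger_iff hϖ).1 y.2
  obtain ⟨r, hsr, hkr⟩ : ∃ r : ℕ+, s ≤ r ∧ k ≤ r :=
    ⟨max s k.succPNat, le_max_left _ _, k.le_succ.trans (le_max_right s k.succPNat)⟩
  have mem : (Amv.Y₀ p E f : Amv p E f) ^ (r : ℕ) * y ∈ AmvDaggerS p hϖ f r := by
    rw [← Nat.sub_add_cancel hkr, pow_add, mul_assoc]
    exact mul_mem (pow_mem (Y₀_mem_AmvDaggerS p hϖ f r) _) (AmvDaggerS_mono p hϖ f hsr hk)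
  have X_mem : AmvDaggerS.X p hϖ f r ∈ Ideal.jacobson ⊥ :=
    IsAdicComplete.le_jacobson_bot _ (Ideal.mem_span_singleton_self _)
  have hle : AmvDaggerS p hϖ f r ≤ AmvDagger p hϖ f := fun a ha =>
    (mem_AmvDagger_iff hϖ).2 ⟨r, le_adjoinInv _ ha⟩
  convert (Ideal.mem_jacobson_bot.1 X_mem ⟨_, mem⟩).map (Subring.inclusion hle) using 1
  refine Subtype.ext ?_
  change Amv.uniformizer p f hϖ * y + 1 =
    (AmvDaggerS.X p hϖ f r).1 * ((Amv.Y₀ p E f : Amv p E f) ^ (r : ℕ) * y) + 1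
  rw [← mul_assoc, ← AmvDaggerS.X_mul_Y_pow p hϖ f r]
  rfl

theorem faithfullyFlat_AmvDagger : Module.FaithfullyFlat (AmvDagger p hϖ f) (Amv p E f) := by
  have := flat_AmvDagger p hϖ f
  refine faithfullyFlat_of_mem_jacobson
    (f := Algebra.linearMap (AmvDagger p hϖ f) (Amv p E f)) Subtype.val_injective
    (uniformizer_mem_jacobson_AmvDagger p hϖ f) ?_ ?_
  · rintro a ⟨b, hb : b.1 = Amv.uniformizer p f hϖ * a⟩
    have mem : Amv.uniformizer p f hϖ * a ∈ AmvDagger p hϖ f := hb ▸ b.2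
    obtain ⟨s, hs⟩ := (mem_AmvDagger_iff hϖ).1 mem
    exact ⟨⟨a, (mem_AmvDagger_iff hϖ).2 ⟨s, mem_AmvDaggerSInv_of_uniformizer_mul_mem hϖ hs⟩⟩, rfl⟩
  · intro a
    obtain ⟨b, hb, c, h⟩ := exists_mem_AmvDaggerSInv_add hϖ (s := 1) a
    exact ⟨⟨b, (mem_AmvDagger_iff hϖ).2 ⟨1, hb⟩⟩, c, h⟩

end Flatness

end MvPhiGamma

theorem mainTheorem7_general (p : ℕ) [Fact p.Prime] (E : Type*) [NormedField E]
    [NormedAlgebra ℚ_[p] E] [FiniteDimensional ℚ_[p] E] {ϖ : E}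
    (hϖ : MvPhiGamma.IsUniformizer ϖ) (f : ℕ) :
    Module.Flat (MvPhiGamma.AmvDaggerInf p hϖ f) (MvPhiGamma.Amv p E f) ∧
      Module.FaithfullyFlat (MvPhiGamma.AmvDagger p hϖ f) (MvPhiGamma.Amv p E f) :=
  ⟨MvPhiGamma.flat_AmvDaggerInf p hϖ f, MvPhiGamma.faithfullyFlat_AmvDagger p hϖ f⟩

theorem mainTheorem7 (p : ℕ) [Fact p.Prime]
    (K : Type*) [Field K] [Algebra ℚ_[p] K] [FiniteDimensional ℚ_[p] K]
    (hK : Algebra.FormallyUnramified (PadicInt.subring p)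
      (integralClosure (PadicInt.subring p) K))
    (E : Type*) [NormedField E] [NormedAlgebra ℚ_[p] E] [FiniteDimensional ℚ_[p] E]
    (σ₀ : K →ₐ[ℚ_[p]] E) (ϖ : E) (hϖ : MvPhiGamma.IsUniformizer ϖ)
    (f : ℕ) (hf : f = Module.finrank ℚ_[p] K) :
    Module.Flat (MvPhiGamma.AmvDaggerInf p hϖ f) (MvPhiGamma.Amv p E f) ∧
      Module.FaithfullyFlat (MvPhiGamma.AmvDagger p hϖ f) (MvPhiGamma.Amv p E f) := by
  exact mainTheorem7_general p E hϖ f
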